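/- **Setting.** Let $\mathcal D$ be a countably infinite set of *data* with a distinguished element $d_0$. A *data word* over a finite alphabet $A$ is an infinite word in $(A\times\mathcal D)^\omega$. A *test* over a finite set $R$ of registers is a Boolean combination (using $\top,\bot,\wedge,\vee,\neg$) of atoms $r^{=}$ and $r^{\neq}$ with $r\in R$; for a valuation $\tau:R\to\mathcal D$ and $d\in\mathcal D$, the atom $r^{=}$ (resp. $r^{\neq}$) holds when $\tau(r)=d$ (resp. $\tau(r)\ne d$). A *non-deterministic register transducer* (NRT) $T$ from a finite alphabet $A$ to a finite alphabet $B$ consists of a finite set $Q$ of states, a finite set $R$ of registers, an initial state $i_0\in Q$, a set $F\subseteq Q$ of accepting states, and a finite set of transitions $(q,\sigma,\phi,\mathsf{asgn},o,q')$ with $q,q'\in Q$, $\sigma\in A$, $\phi$ a test over $R$, $\mathsf{asgn}\subseteq R$ and $o\in(B\times R)^*$. In a configuration $(q,\tau)$, on reading $(\sigma,d)$ such that $d$ satisfies $\phi$ in $\tau$, this transition leads to $(q',\tau')$, where $\tau'(r)=d$ for $r\in\mathsf{asgn}$ and $\tau'(r)=\tau(r)$ otherwise, and outputs the finite data word obtained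 from $o$ by replacing each register $r$ by $\tau'(r)$. A run is an infinite sequence of such steps; it is *accepting* if it starts in $i_0$ with all registers containing $d_0$ and visits some state of $F$ infinitely often. The relation $[\![T]\!]\subseteq(A\times\mathcal D)^\omega\times(B\times\mathcal D)^\omega$ is the set of pairs $(u,v)$ of data words such that some accepting run of $T$ has input $u$ and output (the concatenation of the outputs of its steps) $v$. By convention, a (partial) function or a relation between data words is *definable by an NRT* if its graph, respectively the relation itself, equals $[\![T]\!]$ for some NRT $T$ all of whose accepting runs have infinite output. **Theorem.** Let $A,B,C$ be finite alphabets. 1. If $f:(B\times\mathcal D)^\omega\rightharpoonup(C\times\mathcal D)^\omega$ and $g:(A\times\mathcal D)^\omega\rightharpoonup(B\times\mathcal D)^\omega$ are partial functions definable by NRTs, then their composition $f\circ g:x\mapsto f(g(x))$ is definable by an NRT. 2. More generally, if $r\subseteq (B\times\mathcal D)^\omega\times(C\times\mathcal D)^\omega$ and $s\subseteq (A\times\mathcal D)^\omega\times(B\times\mathcal D)^\omega$ are relations definable by NRTs, then so is their composition $\{(x,z)\mid \exists y,\ (x,y)\in s \text{ and } (y,z)\in r\}$. 3. Both are effective: there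 is an algorithm (a computable function on codes of NRTs, in which states and registers are named by natural numbers) that, given any NRT $T_f$ from $B$ to $C$ and any NRT $T_g$ from $A$ to $B$, computes an NRT $T$ from $A$ to $C$, all of whose accepting runs have infinite output, such that $[\![T]\!]=\{(x,z)\mid \exists y,\ (x,y)\in[\![T_g]\!] \text{ and } (y,z)\in[\![T_f]\!]\}$. In particular, if $[\![T_f]\!]$ and $[\![T_g]\!]$ are the graphs of functions $f$ and $g$, then $[\![T]\!]$ is the graph of $f\circ g$. -/

import Mathlib

/-- Data words over the label alphabet `A` and the data domain `D`: infinite sequences of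
labelled data. -/
abbrev DataWord (A D : Type*) : Type _ := ℕ → A × D

/-- Symbolic tests over a set `R` of registers. -/
inductive RegTest (R : Type*) where
  | top : RegTest R
  | bot : RegTest R
  | eq (r : R) : RegTest R
  | ne (r : R) : RegTest R
  | and (φ ψ : RegTest R) : RegTest R
  | or (φ ψ : RegTest R) : RegTest R
  | not (φ : RegTest R) : RegTest R

/-- `φ.Sat τ d`: the data `d` satisfies the test `φ` in the valuation `τ`. -/
def RegTest.Sat {R D : Type*} (τ : R → D) (d : D) : RegTest R → Prop
  | .top => True
  | .bot => False
  | .eq r => τ r = d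
  | .ne r => τ r ≠ d
  | .and φ ψ => φ.Sat τ d ∧ ψ.Sat τ d
  | .or φ ψ => φ.Sat τ d ∨ ψ.Sat τ d
  | .not φ => ¬ φ.Sat τ d

/-- A transition `src --(letter, test | asgn, out)--> tgt` with states in `Q`, registers in `R`,
input labels in `A` and output labels in `B`. -/
structure RegTransition (A B Q R : Type*) where
  src : Q
  letter : A
  test : RegTest R
  asgn : Set R
  out : List (B × R)
  tgt : Q

/-- Non-deterministic register transducers with input labels in `A` and output labels in `B`. -/
structure NRT (A B : Type*) where
  Q : Type
  R : Type
  finite_Q : Finite Q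
  finite_R : Finite R
  init : Q
  accepting : Set Q
  trans : Set (RegTransition A B Q R)
  finite_trans : trans.Finite

namespace NRT

variable {A B D : Type*}

/-- Configurations: a state and a valuation of the registers. -/
abbrev Config (T : NRT A B) (D : Type*) : Type _ := T.Q × (T.R → D)

/-- One step of the labelled transition system of `T`: from the configuration `c`, reading the
labelled data `l` and writing the finite data word `w`, to the configuration `c'`. -/
def Step (T : NRT A B) (c : T.Config D) (l : A × D) (w : List (B × D)) (c' : T.Config D) : Prop :=
  ∃ t ∈ T.trans, t.src = c.1 ∧ t.tgt = c'.1 ∧ t.letter = l.1 ∧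
    t.test.Sat c.2 l.2 ∧
    (∀ r ∈ t.asgn, c'.2 r = l.2) ∧ (∀ r ∉ t.asgn, c'.2 r = c.2 r) ∧
    w = t.out.map (fun x => (x.1, c'.2 x.2))

/-- A run: an infinite sequence of configurations, linked by labelled steps. -/
structure Run (T : NRT A B) (D : Type*) where
  config : ℕ → T.Config D
  input : ℕ → A × D
  output : ℕ → List (B × D)
  step : ∀ n, T.Step (config n) (input n) (output n) (config (n + 1))

/-- The output of the first `n` steps of a run. -/
def Run.outputUpTo {T : NRT A B} (ρ : T.Run D) (n : ℕ) : List (B × D) :=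
  (List.range n).flatMap ρ.output

/-- The output of the run is infinite. -/
def Run.InfiniteOutput {T : NRT A B} (ρ : T.Run D) : Prop :=
  ∀ N, ∃ n, N ≤ (ρ.outputUpTo n).length

/-- The output of the run is the infinite word `v`. -/
def Run.HasOutput {T : NRT A B} (ρ : T.Run D) (v : DataWord B D) : Prop :=
  ρ.InfiniteOutput ∧ ∀ n, ρ.outputUpTo n = (List.range (ρ.outputUpTo n).length).map v

/-- A run is accepting if it starts in the initial state with all registers containing `d₀`, and
visits some accepting state infinitely often. -/
def Run.Accepting {T : NRT A B} (d₀ : D) (ρ : T.Run D) : Prop :=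
  ρ.config 0 = (T.init, fun _ => d₀) ∧
    ∃ q ∈ T.accepting, ∃ᶠ n in Filter.atTop, (ρ.config n).1 = q

/-- All accepting runs of `T` have infinite outputs. -/
def InfiniteOutputs (d₀ : D) (T : NRT A B) : Prop :=
  ∀ ρ : T.Run D, ρ.Accepting d₀ → ρ.InfiniteOutput

/-- The relation between data words that is defined by `T`. -/
def rel (d₀ : D) (T : NRT A B) : SetRel (DataWord A D) (DataWord B D) :=
  {p | ∃ ρ : T.Run D, ρ.Accepting d₀ ∧ ρ.input = p.1 ∧ ρ.HasOutput p.2}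

/-- The relation `r` is definable by a register transducer. -/
def DefinableRel (d₀ : D) (r : SetRel (DataWord A D) (DataWord B D)) : Prop :=
  ∃ T : NRT A B, T.InfiniteOutputs d₀ ∧ T.rel d₀ = r

/-- The (partial) function `f` is definable by a register transducer. -/
def DefinableFun (d₀ : D) (f : DataWord A D →. DataWord B D) : Prop :=
  ∃ T : NRT A B, T.InfiniteOutputs d₀ ∧ T.rel d₀ = f.graph

end NRT

/-! ### Finite presentations of transducers, as inputs and outputs of algorithms -/

/-- A test written in postfix notation, where the register `r` is named by the number `ν r`.
A symbol is a pair consisting of the kind of the symbol and, for the atoms, of the register. -/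
def RegTest.postfix {R : Type*} (ν : R → ℕ) : RegTest R → List (ℕ × ℕ)
  | .top => [(0, 0)]
  | .bot => [(1, 0)]
  | .and φ ψ => φ.postfix ν ++ ψ.postfix ν ++ [(2, 0)]
  | .or φ ψ => φ.postfix ν ++ ψ.postfix ν ++ [(3, 0)]
  | .not φ => φ.postfix ν ++ [(4, 0)]
  | .eq r => [(5, ν r)]
  | .ne r => [(6, ν r)]

/-- The list `l` enumerates (in some order, possibly with repetitions) the names of the
elements of `s`. -/
def ListNames {X : Type*} (ν : X → ℕ) (l : List ℕ) (s : Set X) : Prop :=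
  ∀ n, n ∈ l ↔ ∃ x ∈ s, ν x = n

/-- Codes of transitions: source, input label, test, assigned registers, output, target. -/
abbrev TransitionCode (A B : Type*) : Type _ :=
  ℕ × A × List (ℕ × ℕ) × List ℕ × List (B × ℕ) × ℕ

/-- `c` is a code of the transition `t` under the namings `νQ` of states and `νR` of registers. -/
def TransitionCode.Codes {A B Q R : Type*} (νQ : Q → ℕ) (νR : R → ℕ) (c : TransitionCode A B)
    (t : RegTransition A B Q R) : Prop :=
  match c with
  | (src, letter, test, asgn, out, tgt) =>
    src = νQ t.src ∧ letter = t.letter ∧ test = t.test.postfix νR ∧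
      ListNames νR asgn t.asgn ∧ out = t.out.map (fun x => (x.1, νR x.2)) ∧ tgt = νQ t.tgt

/-- Codes of transducers: states, registers, initial state, accepting states, transitions. -/
abbrev NRTCode (A B : Type*) : Type _ :=
  List ℕ × List ℕ × ℕ × List ℕ × List (TransitionCode A B)

/-- `c` is a code of `T`, for some naming of the states and of the registers of `T` by
natural numbers. -/
def NRTCode.Codes {A B : Type*} (c : NRTCode A B) (T : NRT A B) : Prop :=
  match c with
  | (states, registers, init, accepting, transitions) =>
    ∃ (νQ : T.Q → ℕ) (νR : T.R → ℕ), Function.Injective νQ ∧ Function.Injective νR ∧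
      ListNames νQ states Set.univ ∧ ListNames νR registers Set.univ ∧
      init = νQ T.init ∧ ListNames νQ accepting T.accepting ∧
      (∀ t ∈ T.trans, ∃ k ∈ transitions, TransitionCode.Codes νQ νR k t) ∧
      (∀ k ∈ transitions, ∃ t ∈ T.trans, TransitionCode.Codes νQ νR k t)

theorem ListNames.exists_of_finite {X : Type*} (ν : X → ℕ) {s : Set X} (hs : s.Finite) :
    ∃ l : List ℕ, ListNames ν l s := by
  refine ⟨(hs.image ν).toFinset.toList, fun n => ?_⟩
  simp

/-- Every transducer has a code. -/
theorem NRTCode.exists_codes {A B : Type*} (T : NRT A B) : ∃ c : NRTCode A B, c.Codes T := by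
  classical
  have hQ := T.finite_Q
  have hR := T.finite_R
  obtain ⟨νQ, hνQ⟩ := exists_injective_nat T.Q
  obtain ⟨νR, hνR⟩ := exists_injective_nat T.R
  obtain ⟨lQ, hlQ⟩ := ListNames.exists_of_finite νQ (Set.toFinite (Set.univ : Set T.Q))
  obtain ⟨lR, hlR⟩ := ListNames.exists_of_finite νR (Set.toFinite (Set.univ : Set T.R))
  obtain ⟨lF, hlF⟩ := ListNames.exists_of_finite νQ (Set.toFinite T.accepting)
  choose g hg using fun t : RegTransition A B T.Q T.R =>
    ListNames.exists_of_finite νR (Set.toFinite t.asgn)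
  let code : RegTransition A B T.Q T.R → TransitionCode A B := fun t =>
    (νQ t.src, t.letter, t.test.postfix νR, g t, t.out.map (fun x => (x.1, νR x.2)), νQ t.tgt)
  have hcode : ∀ t, TransitionCode.Codes νQ νR (code t) t :=
    fun t => ⟨rfl, rfl, rfl, hg t, rfl, rfl⟩
  refine ⟨(lQ, lR, νQ T.init, lF, (T.finite_trans.image code).toFinset.toList),
    νQ, νR, hνQ, hνR, hlQ, hlR, rfl, hlF, ?_, ?_⟩
  · intro t ht
    exact ⟨code t, by simpa using ⟨t, ht, rfl⟩, hcode t⟩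
  · intro k hk
    obtain ⟨t, ht, rfl⟩ : ∃ t ∈ T.trans, code t = k := by simpa using hk
    exact ⟨t, ht, hcode t⟩

/-! The composition runs both transducers at once. In one step it fires a transition of the inner
transducer on the input datum, then lets the outer one read the finite word just produced. If that
word is empty, the outer transducer waits.

The difficulty is that the outer transducer tests data that are not input at that moment. However,
every datum the inner one writes lies in one of its registers, so it suffices to know which
registers of the two transducers hold equal data. If `N` bounds the register names, there are at
most `2 * N` simulated registers. A pool of `2 * N + 1` real registers holds their contents, and a
location list in the control state tells where each content is. Invariant: locations in use hold
pairwise distinct data (`PairRep.inj`). A transition guesses the pool register `p` where the input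
datum belongs: the one in use that already holds it, or an unused one if there is none. Its test
verifies the guess (`poolTest`, `Fits`). From then on all tests compare locations and are decided
statically (`Represents.staticTest_eq`). Assignments only move locations, and the pool is written
once per step, at `p`. So all output letters collected along the simulated outer path can be
evaluated in the same final pool.

An accepting run of the composition must visit accepting states of both transducers infinitely often
and write infinitely often. Three flags, reset when all are up, express this as one Büchi condition
(`frequently_allFlags_iff`). The writing condition gives infinite output, and it also makes the
intermediate word infinite, since output requires outer steps. Runs are translated by
`AccRun.exists_of_compose` and `AccRun.compose`, which differ only in whether the outer run is
indexed by its letters or by the inner steps; the `HasConcat` lemmas pass between the two.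

For effectiveness, the construction works on codes. It consists of finite enumerations and folds,
hence is primitive recursive, and `Codes.mem_rel_iff` shows that the relation of a transducer can be
read off any of its codes. -/

/-! ### Concatenations of infinite sequences of finite words -/

section Concat

open Filter

variable {X Y : Type*}

/-- The concatenation of the first `n` words. -/
def concatUpTo (ws : ℕ → List X) (n : ℕ) : List X := (List.range n).flatMap ws

/-- The infinite word `v` is the concatenation of the words `ws n`. -/
def HasConcat (ws : ℕ → List X) (v : ℕ → X) : Prop :=
  (∀ N, ∃ n, N ≤ (concatUpTo ws n).length) ∧
    ∀ n, concatUpTo ws n = (List.range (concatUpTo ws n).length).map v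

@[simp] theorem concatUpTo_zero (ws : ℕ → List X) : concatUpTo ws 0 = [] := rfl

theorem concatUpTo_succ (ws : ℕ → List X) (n : ℕ) :
    concatUpTo ws (n + 1) = concatUpTo ws n ++ ws n := by
  simp [concatUpTo, List.range_succ]

theorem concatUpTo_prefix (ws : ℕ → List X) {m n : ℕ} (h : m ≤ n) :
    concatUpTo ws m <+: concatUpTo ws n := by
  induction n, h using Nat.le_induction with
  | base => exact List.prefix_rfl
  | succ n _ ih => exact ih.trans (concatUpTo_succ ws n ▸ List.prefix_append _ _)

theorem concatUpTo_length_mono (ws : ℕ → List X) {m n : ℕ} (h : m ≤ n) :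
    (concatUpTo ws m).length ≤ (concatUpTo ws n).length :=
  (concatUpTo_prefix ws h).length_le

theorem concatUpTo_map (ws : ℕ → List X) (f : X → Y) (n : ℕ) :
    concatUpTo (fun n => (ws n).map f) n = (concatUpTo ws n).map f := by
  simp [concatUpTo, List.map_flatMap]

/-- Turns infinite output into an event that recurs, the form in which a Büchi condition can monitor
it. -/
theorem infinite_concat_iff {ws : ℕ → List X} :
    (∀ N, ∃ n, N ≤ (concatUpTo ws n).length) ↔ ∃ᶠ n in atTop, ws n ≠ [] := by
  rw [frequently_atTop]
  constructor
  · intro h N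
    by_contra! hc
    have hlen (n : ℕ) (hn : N ≤ n) : (concatUpTo ws n).length = (concatUpTo ws N).length := by
      induction n, hn using Nat.le_induction with
      | base => rfl
      | succ n hn ih => rw [concatUpTo_succ, hc n hn, List.append_nil, ih]
    obtain ⟨n, hn⟩ := h ((concatUpTo ws N).length + 1)
    have h1 := concatUpTo_length_mono ws (le_max_left n N)
    have h2 := hlen (max n N) (le_max_right n N)
    omega
  · intro h N
    induction N with
    | zero => exact ⟨0, Nat.zero_le _⟩
    | succ N ih =>
      obtain ⟨n, hn⟩ := ih
      obtain ⟨m, hm, hne⟩ := h n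
      refine ⟨m + 1, ?_⟩
      have h1 := concatUpTo_length_mono ws hm
      have h2 := List.length_pos_iff.mpr hne
      rw [concatUpTo_succ, List.length_append]
      omega

theorem eq_map_range_iff {l : List X} {v : ℕ → X} :
    l = (List.range l.length).map v ↔ ∀ i (h : i < l.length), l[i] = v i := by
  constructor
  · intro h i hi
    rw [List.getElem_of_eq h]
    simp
  · intro h
    exact List.ext_getElem (by simp) fun i h1 _ => by simp [h i h1]

theorem eq_map_range_of_prefix {l l' : List X} {v : ℕ → X} (h : l <+: l')
    (h' : l' = (List.range l'.length).map v) : l = (List.range l.length).map v := by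
  rw [eq_map_range_iff] at *
  intro i hi
  rw [h.getElem hi, h']

/-- The finite concatenations form a chain of prefixes, so letter `i` may be read off any one that
is long enough. -/
theorem exists_hasConcat {ws : ℕ → List X} (h : ∀ N, ∃ n, N ≤ (concatUpTo ws n).length) :
    ∃ v, HasConcat ws v := by
  choose n hn using fun i => h (i + 1)
  refine ⟨fun i => (concatUpTo ws (n i))[i]'(hn i), h, fun m => eq_map_range_iff.mpr ?_⟩
  intro i hi
  rcases le_total m (n i) with hm | hm
  · exact (concatUpTo_prefix ws hm).getElem hi
  · exact ((concatUpTo_prefix ws hm).getElem (hn i)).symm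

theorem HasConcat.map {ws : ℕ → List X} {v : ℕ → X} (h : HasConcat ws v) (f : X → Y) :
    HasConcat (fun n => (ws n).map f) fun i => f (v i) := by
  refine ⟨fun N => ?_, fun n => ?_⟩
  · simpa [concatUpTo_map] using h.1 N
  · rw [concatUpTo_map, List.length_map, ← Function.comp_def f v, ← List.map_map, ← h.2]

/-- The words are consecutive slices of their concatenation. -/
theorem HasConcat.slice {ws : ℕ → List X} {v : ℕ → X} (h : HasConcat ws v) (n : ℕ) :
    ws n = (List.range (ws n).length).map fun i => v ((concatUpTo ws n).length + i) := by
  rw [eq_map_range_iff]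
  intro i hi
  have h1 := eq_map_range_iff.mp (h.2 (n + 1)) ((concatUpTo ws n).length + i)
    (by rw [concatUpTo_succ, List.length_append]; omega)
  simpa [concatUpTo_succ] using h1

theorem HasConcat.of_slice {ws : ℕ → List X} {v : ℕ → X}
    (h : ∀ N, ∃ n, N ≤ (concatUpTo ws n).length)
    (hs : ∀ n, ws n = (List.range (ws n).length).map fun i => v ((concatUpTo ws n).length + i)) :
    HasConcat ws v := by
  refine ⟨h, fun n => ?_⟩
  induction n with
  | zero => rfl
  | succ n ih =>
    rw [concatUpTo_succ, List.length_append, List.range_add, List.map_append, ← ih,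
      List.map_map]
    congr 1
    exact hs n

theorem HasConcat.exists_slice {ws : ℕ → List X} {v : ℕ → X} (h : HasConcat ws v) (j : ℕ) :
    ∃ n, (concatUpTo ws n).length ≤ j ∧ j < (concatUpTo ws (n + 1)).length := by
  classical
  have hex : ∃ n, j < (concatUpTo ws n).length := h.1 (j + 1)
  obtain ⟨n, hn⟩ : ∃ n, Nat.find hex = n + 1 := by
    refine Nat.exists_eq_succ_of_ne_zero fun h0 => ?_
    have := Nat.find_spec hex
    rw [h0] at this
    simp at this
  exact ⟨n, not_lt.mp (Nat.find_min hex (by omega)), hn ▸ Nat.find_spec hex⟩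

/-- Transfers the acceptance of the outer run between single firings and the blocks grouped by inner
steps. -/
theorem HasConcat.frequently_iff {ws : ℕ → List X} {v : ℕ → X} (h : HasConcat ws v)
    (P : X → Prop) : (∃ᶠ j in atTop, P (v j)) ↔ ∃ᶠ n in atTop, ∃ x ∈ ws n, P x := by
  simp only [frequently_atTop]
  constructor
  · intro hP N
    obtain ⟨j, hj, hPj⟩ := hP (concatUpTo ws N).length
    obtain ⟨n, h1, h2⟩ := h.exists_slice j
    refine ⟨n, ?_, v j, ?_, hPj⟩
    · by_contra! hn
      have := concatUpTo_length_mono ws (Nat.succ_le_of_lt hn)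
      simp only [Nat.succ_eq_add_one] at this
      omega
    · rw [h.slice n, List.mem_map]
      rw [concatUpTo_succ, List.length_append] at h2
      exact ⟨j - (concatUpTo ws n).length, List.mem_range.mpr (by omega), by congr 1; omega⟩
  · intro hP J
    obtain ⟨N, hN⟩ := h.1 J
    obtain ⟨n, hn, x, hx, hPx⟩ := hP N
    rw [h.slice n, List.mem_map] at hx
    obtain ⟨i, -, rfl⟩ := hx
    have := concatUpTo_length_mono ws hn
    exact ⟨_, by omega, hPx⟩

theorem HasConcat.concatUpTo_flatMap {ws : ℕ → List X} {v : ℕ → X} (h : HasConcat ws v)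
    (f : X → List Y) (n : ℕ) :
    concatUpTo (fun n => (ws n).flatMap f) n =
      concatUpTo (fun i => f (v i)) (concatUpTo ws n).length := by
  have h1 : concatUpTo (fun n => (ws n).flatMap f) n = (concatUpTo ws n).flatMap f := by
    simp [concatUpTo, List.flatMap_assoc]
  rw [h1]
  conv_lhs => rw [h.2 n]
  rw [List.flatMap_map]
  rfl

/-- Grouping into blocks only passes to a cofinal subsequence of the finite concatenations, which
has the same limit. -/
theorem HasConcat.flatMap_iff {ws : ℕ → List X} {v : ℕ → X} (h : HasConcat ws v)
    (f : X → List Y) {z : ℕ → Y} :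
    HasConcat (fun n => (ws n).flatMap f) z ↔ HasConcat (fun i => f (v i)) z := by
  constructor
  · intro hz
    refine ⟨fun N => ?_, fun j => ?_⟩
    · obtain ⟨n, hn⟩ := hz.1 N
      exact ⟨_, (h.concatUpTo_flatMap f n) ▸ hn⟩
    · obtain ⟨n, hn⟩ := h.1 j
      have := hz.2 n
      rw [h.concatUpTo_flatMap f n] at this
      exact eq_map_range_of_prefix (concatUpTo_prefix _ hn) this
  · intro hz
    refine ⟨fun N => ?_, fun n => ?_⟩
    · obtain ⟨j, hj⟩ := hz.1 N
      obtain ⟨n, hn⟩ := h.1 j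
      exact ⟨n, (h.concatUpTo_flatMap f n) ▸ hj.trans (concatUpTo_length_mono _ hn)⟩
    · rw [h.concatUpTo_flatMap f n]
      exact hz.2 _

/-- A sequence constructed step by step. -/
theorem exists_seq_of_step (P : ℕ → X → Prop) (R : ℕ → X → X → Prop) {x₀ : X} (h₀ : P 0 x₀)
    (hstep : ∀ n x, P n x → ∃ x', P (n + 1) x' ∧ R n x x') :
    ∃ u : ℕ → X, u 0 = x₀ ∧ ∀ n, P n (u n) ∧ R n (u n) (u (n + 1)) := by
  choose! g hg using hstep
  let u : ℕ → X := fun n => Nat.rec x₀ (fun n x => g n x) n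
  have hP (n : ℕ) : P n (u n) := by
    induction n with
    | zero => exact h₀
    | succ n ih => exact (hg n _ ih).1
  exact ⟨u, rfl, fun n => ⟨hP n, (hg n _ (hP n)).2⟩⟩

end Concat

/-! ### Static evaluation of tests -/

/-- One step of the stack machine that evaluates tests in postfix notation. The truth value of
`r^=` is `atom r`. -/
def evalSymbol (atom : ℕ → Bool) (st : List Bool) (s : ℕ × ℕ) : List Bool :=
  if s.1 = 0 then true :: st
  else if s.1 = 1 then false :: st
  else if s.1 = 2 then (st.tail.headI && st.headI) :: st.tail.tail
  else if s.1 = 3 then (st.tail.headI || st.headI) :: st.tail.tail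
  else if s.1 = 4 then (!st.headI) :: st.tail
  else if s.1 = 5 then atom s.2 :: st
  else (!atom s.2) :: st

/-- The truth value of a test in postfix notation. -/
def evalPostfix (atom : ℕ → Bool) (l : List (ℕ × ℕ)) : Bool :=
  (l.foldl (evalSymbol atom) []).headI

/-- Postfix notation replaces recursion over syntax trees by a left fold with a stack of truth
values. -/
theorem primrec_evalPostfix {α : Type*} [Primcodable α] {atom : α → ℕ → Bool}
    {l : α → List (ℕ × ℕ)} (ha : Primrec₂ atom) (hl : Primrec l) :
    Primrec fun a => evalPostfix (atom a) (l a) := by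
  have hst : Primrec fun x : α × List Bool × ℕ × ℕ => x.2.1 := .comp .fst .snd
  have hk : Primrec fun x : α × List Bool × ℕ × ℕ => x.2.2.1 :=
    .comp .fst (.comp .snd .snd)
  have hr : Primrec fun x : α × List Bool × ℕ × ℕ => x.2.2.2 :=
    .comp .snd (.comp .snd .snd)
  have hat : Primrec fun x : α × List Bool × ℕ × ℕ => atom x.1 x.2.2.2 := ha.comp .fst hr
  have hh := Primrec.list_headI.comp hst
  have ht := Primrec.list_tail.comp hst
  have hth := Primrec.list_headI.comp ht
  have htt := Primrec.list_tail.comp ht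
  have heq (n : ℕ) : PrimrecPred fun x : α × List Bool × ℕ × ℕ => x.2.2.1 = n :=
    Primrec.eq.comp hk (.const n)
  refine Primrec.list_headI.comp (Primrec.list_foldl hl (.const [])
    (h := fun a x => evalSymbol (atom a) x.1 x.2) ?_)
  refine .ite (heq 0) (Primrec.list_cons.comp (.const true) hst) ?_
  refine .ite (heq 1) (Primrec.list_cons.comp (.const false) hst) ?_
  refine .ite (heq 2) (Primrec.list_cons.comp (Primrec.and.comp hth hh) htt) ?_
  refine .ite (heq 3) (Primrec.list_cons.comp (Primrec.or.comp hth hh) htt) ?_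
  refine .ite (heq 4) (Primrec.list_cons.comp (Primrec.not.comp hh) ht) ?_
  refine .ite (heq 5) (Primrec.list_cons.comp hat hst) ?_
  exact Primrec.list_cons.comp (Primrec.not.comp hat) hst

theorem primrec_mem {α : Type*} [Primcodable α] {x : α → ℕ} {l : α → List ℕ}
    (hx : Primrec x) (hl : Primrec l) : PrimrecPred fun a => x a ∈ l a :=
  ((Primrec.eq (α := ℕ)).exists_mem_list.comp hl hx).of_eq fun a => by simp

theorem primrec_sum {α : Type*} [Primcodable α] {l : α → List ℕ} (hl : Primrec l) :
    Primrec fun a => (l a).sum :=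
  (Primrec.list_foldr (h := fun _ x => x.1 + x.2) hl (.const 0)
    (Primrec.nat_add.comp (.comp .fst .snd) (.comp .snd .snd))).of_eq fun a => by
      simp [List.sum_eq_foldr]

theorem primrec_two_mul_add {α : Type*} [Primcodable α] {x e : α → ℕ}
    (hx : Primrec x) (he : Primrec e) : Primrec fun a => 2 * x a + e a :=
  Primrec.nat_add.comp (Primrec.nat_double.comp hx) he

/-! ### The transducer for the composition -/

namespace NRTCode

variable {A B C : Type*}

/-- In the composition, the contents of the registers of both transducers are kept in a pool of
registers. A *location list* `m` says where: the register `r` of the inner transducer is in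
`m[2 * r]`, the register `r` of the outer one is in `m[2 * r + 1]`. The truth value of a test of
the inner (`e = 0`) or outer (`e = 1`) transducer on the datum in `p`, when different locations
hold different data. -/
def staticTest (e p : ℕ) (m : List ℕ) (test : List (ℕ × ℕ)) : Bool :=
  evalPostfix (fun r => m.getD (2 * r + e) 0 == p) test

/-- The location list of length `M` after `p` has been assigned to the registers in `asgn`. -/
def relocate (M e p : ℕ) (m : List ℕ) (asgn : List ℕ) : List ℕ :=
  (List.range M).map fun i => if i % 2 = e ∧ i / 2 ∈ asgn then p else m.getD i 0

/-- An intermediate result of the simulation of the outer transducer: state, location list,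
output, and whether an accepting state has been visited. -/
abbrev Partial (C : Type*) : Type _ := ℕ × List ℕ × List (C × ℕ) × Bool

/-- The intermediate result after the transition `k` on the datum in `p`. -/
def advance (acc : List ℕ) (M p : ℕ) (x : Partial C) (k : TransitionCode B C) : Partial C :=
  (k.2.2.2.2.2, relocate M 1 p x.2.1 k.2.2.2.1,
    x.2.2.1 ++ k.2.2.2.2.1.map
      (fun y => (y.1, (relocate M 1 p x.2.1 k.2.2.2.1).getD (2 * y.2 + 1) 0)),
    x.2.2.2 || decide (k.2.2.2.2.2 ∈ acc))

/-- All intermediate results after the letter `y`, in which data are given by registers of the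
inner transducer. -/
def feed [Encodable B] (acc : List ℕ) (trans : List (TransitionCode B C)) (M : ℕ) (x : Partial C)
    (y : B × ℕ) : List (Partial C) :=
  trans.flatMap fun k =>
    -- Labels are compared through their encodings, so decidable equality on `B` is not needed.
    if (k.1 = x.1 ∧ Encodable.encode k.2.1 = Encodable.encode y.1) ∧
        staticTest 1 (x.2.1.getD (2 * y.2 + 0) 0) x.2.1 k.2.2.1 = true then
      [advance acc M (x.2.1.getD (2 * y.2 + 0) 0) x k] else []

/-- All intermediate results after a word. -/
def feedAll [Encodable B] (acc : List ℕ) (trans : List (TransitionCode B C)) (M : ℕ)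
    (x : Partial C) (w : List (B × ℕ)) : List (Partial C) :=
  w.foldl (fun L y => L.flatMap fun x => feed acc trans M x y) [x]

/-- States of the composition: the states of the inner and of the outer transducer, a location
list, and three flags for the three events that have to occur infinitely often. -/
abbrev PairState : Type := (ℕ × ℕ) × List ℕ × Bool × Bool × Bool

def allFlags (fl : Bool × Bool × Bool) : Bool := fl.1 && (fl.2.1 && fl.2.2)

/-- Raise the flags of the events that occur, after a reset if all flags are up. -/
def raiseFlags (fl ev : Bool × Bool × Bool) : Bool × Bool × Bool :=
  ((!allFlags fl && fl.1) || ev.1, (!allFlags fl && fl.2.1) || ev.2.1,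
    (!allFlags fl && fl.2.2) || ev.2.2)

/-- The test that the datum belongs in the register `p` of the pool, when the registers in `m` are
in use. -/
def poolTest (p : ℕ) (m : List ℕ) : List (ℕ × ℕ) :=
  if p ∈ m then [(5, p)] else (0, 0) :: m.flatMap fun q => [(6, q), (2, 0)]

/-- All lists of length `M` with entries below `n`. -/
def tuples (n M : ℕ) : List (List ℕ) :=
  Nat.rec [[]] (fun _ L => L.flatMap fun l => (List.range n).map fun p => p :: l) M

/-- A bound for the names of the registers. -/
def numRegs (cf : NRTCode B C) (cg : NRTCode A B) : ℕ := cf.2.1.sum + cg.2.1.sum + 1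

/-- The entries of a list range over `2 * N + 1` pool registers while its length is `2 * N`: one
register is always unused. -/
def pairStates (cf : NRTCode B C) (cg : NRTCode A B) : List PairState :=
  cg.1.flatMap fun qg => cf.1.flatMap fun qf =>
    (tuples (2 * numRegs cf cg + 1) (2 * numRegs cf cg)).flatMap fun m =>
      [false, true].flatMap fun a => [false, true].flatMap fun b => [false, true].map fun c =>
        ((qg, qf), m, a, b, c)

/-- The location list after the transition `k` of the inner transducer on the datum in `p`. -/
def innerLocs (N p : ℕ) (s : PairState) (k : TransitionCode A B) : List ℕ :=
  relocate (2 * N) 0 p s.2.1 k.2.2.2.1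

/-- The three events are: the inner transducer enters an accepting state, the outer one enters one
somewhere along its path, and the output word is nonempty. -/
def pairSucc (gacc : List ℕ) (s : PairState) (k : TransitionCode A B) (x : Partial C) :
    PairState :=
  ((k.2.2.2.2.2, x.1), x.2.1,
    raiseFlags s.2.2 (decide (k.2.2.2.2.2 ∈ gacc), x.2.2.2, !decide (x.2.2.1 = [])))

/-- The transitions from the state `s` that read a datum belonging in `p` and simulate the
transition `k` of the inner transducer. -/
def pairTrans [Encodable B] (cf : NRTCode B C) (cg : NRTCode A B) (s : PairState) (p : ℕ)
    (k : TransitionCode A B) : List (TransitionCode A C) :=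
  if k.1 = s.1.1 ∧ staticTest 0 p s.2.1
      k.2.2.1 = true then
    (feedAll cf.2.2.2.1 cf.2.2.2.2 (2 * numRegs cf cg)
      (s.1.2, innerLocs (numRegs cf cg) p s k, [], false) k.2.2.2.2.1).map fun x =>
      (Encodable.encode s, k.2.1, poolTest p s.2.1, [p], x.2.2.1,
        Encodable.encode (pairSucc cg.2.2.2.1 s k x))
  else []

/-- A code of a transducer for the composition. -/
def compose [Encodable B] (cf : NRTCode B C) (cg : NRTCode A B) : NRTCode A C :=
  ((pairStates cf cg).map Encodable.encode,
    List.range (2 * numRegs cf cg + 1),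
    -- All registers initially hold the same datum, so they must share one location, here `0`.
    Encodable.encode (((cg.2.2.1, cf.2.2.1), (List.range (2 * numRegs cf cg)).map fun _ => 0,
      false, false, false) : PairState),
    (pairStates cf cg).flatMap fun s => if allFlags s.2.2 = true then [Encodable.encode s] else [],
    (pairStates cf cg).flatMap fun s => (List.range (2 * numRegs cf cg + 1)).flatMap fun p =>
      cg.2.2.2.2.flatMap fun k => pairTrans cf cg s p k)

/-! ### Primitive recursiveness of the construction -/

section Primrec

variable {A B C α : Type*} [Primcodable A] [Primcodable B] [Primcodable C] [Primcodable α]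

theorem primrec_staticTest (e : ℕ) {p : α → ℕ} {m : α → List ℕ} {l : α → List (ℕ × ℕ)}
    (hp : Primrec p) (hm : Primrec m) (hl : Primrec l) :
    Primrec fun a => staticTest e (p a) (m a) (l a) :=
  primrec_evalPostfix (Primrec.beq.comp
    ((Primrec.list_getD 0).comp (hm.comp .fst) (primrec_two_mul_add .snd (.const e)))
    (hp.comp .fst)) hl

theorem primrec_relocate (e : ℕ) {M p : α → ℕ} {m asgn : α → List ℕ}
    (hM : Primrec M) (hp : Primrec p) (hm : Primrec m) (ha : Primrec asgn) :
    Primrec fun a => relocate (M a) e (p a) (m a) (asgn a) := by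
  refine Primrec.list_map (Primrec.list_range.comp hM) (Primrec.ite (.and ?_ ?_)
    (hp.comp .fst) ((Primrec.list_getD 0).comp (hm.comp .fst) .snd))
  · exact Primrec.eq.comp (Primrec.nat_mod.comp .snd (.const 2)) (.const e)
  · exact primrec_mem (Primrec.nat_div.comp .snd (.const 2)) (ha.comp .fst)

theorem primrec_tuples {n M : α → ℕ} (hn : Primrec n) (hM : Primrec M) :
    Primrec fun a => tuples (n a) (M a) := by
  refine Primrec.nat_rec' (h := fun a x => x.2.flatMap fun l =>
    (List.range (n a)).map fun p => p :: l) hM (.const [[]]) ?_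
  refine Primrec.list_flatMap (.comp .snd .snd) (Primrec.list_map ?_ ?_)
  · exact Primrec.list_range.comp (hn.comp (.comp .fst .fst))
  · exact Primrec.list_cons.comp .snd (.comp .snd .fst)

theorem primrec_poolTest {p : α → ℕ} {m : α → List ℕ} (hp : Primrec p) (hm : Primrec m) :
    Primrec fun a => poolTest (p a) (m a) := by
  refine Primrec.ite (primrec_mem hp hm)
    (Primrec.list_cons.comp (.pair (.const 5) hp) (.const []))
    (Primrec.list_cons.comp (.const (0, 0)) (Primrec.list_flatMap hm ?_))
  exact Primrec.list_cons.comp (.pair (.const 6) .snd) (.const [(2, 0)])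

theorem primrec_advance {acc : α → List ℕ} {M p : α → ℕ} {x : α → Partial C}
    {k : α → TransitionCode B C} (hacc : Primrec acc) (hM : Primrec M) (hp : Primrec p)
    (hx : Primrec x) (hk : Primrec k) :
    Primrec fun a => advance (acc a) (M a) (p a) (x a) (k a) := by
  have hk1 := Primrec.snd.comp (Primrec.snd.comp (Primrec.snd.comp hk))
  have hout := Primrec.fst.comp (Primrec.snd.comp hk1)
  have htgt := Primrec.snd.comp (Primrec.snd.comp hk1)
  have hm := Primrec.fst.comp (Primrec.snd.comp hx)
  have hrel := primrec_relocate 1 hM hp hm (Primrec.fst.comp hk1)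
  refine .pair htgt (.pair hrel (.pair ?_ ?_))
  · refine Primrec.list_append.comp (Primrec.fst.comp (Primrec.snd.comp (Primrec.snd.comp hx)))
      (Primrec.list_map hout (Primrec.pair (.comp .fst .snd) ?_))
    exact (Primrec.list_getD 0).comp (hrel.comp .fst)
      (primrec_two_mul_add (.comp .snd .snd) (.const 1))
  · exact Primrec.or.comp (Primrec.snd.comp (Primrec.snd.comp (Primrec.snd.comp hx)))
      (primrec_mem htgt hacc).decide

theorem primrec_feed {acc : α → List ℕ} {trans : α → List (TransitionCode B C)} {M : α → ℕ}
    {x : α → Partial C} {y : α → B × ℕ} (hacc : Primrec acc) (htrans : Primrec trans)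
    (hM : Primrec M) (hx : Primrec x) (hy : Primrec y) :
    Primrec fun a => feed (acc a) (trans a) (M a) (x a) (y a) := by
  have hm := Primrec.fst.comp (Primrec.snd.comp hx)
  have hp := (Primrec.list_getD 0).comp hm
    (primrec_two_mul_add (Primrec.snd.comp hy) (.const 0))
  refine Primrec.list_flatMap htrans (Primrec.ite (.and (.and ?_ ?_) ?_) ?_ (.const []))
  · exact Primrec.eq.comp (.comp .fst .snd) (.comp .fst (hx.comp .fst))
  · exact Primrec.eq.comp (Primrec.encode.comp (.comp .fst (.comp .snd .snd)))
      (Primrec.encode.comp (.comp .fst (hy.comp .fst)))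
  · exact Primrec.eq.comp (primrec_staticTest 1 (hp.comp .fst) (hm.comp .fst)
      (.comp .fst (.comp .snd (.comp .snd .snd)))) (.const true)
  · exact Primrec.list_cons.comp (primrec_advance (hacc.comp .fst) (hM.comp .fst) (hp.comp .fst)
      (hx.comp .fst) .snd) (.const [])

theorem primrec_feedAll {acc : α → List ℕ} {trans : α → List (TransitionCode B C)} {M : α → ℕ}
    {x : α → Partial C} {w : α → List (B × ℕ)} (hacc : Primrec acc) (htrans : Primrec trans)
    (hM : Primrec M) (hx : Primrec x) (hw : Primrec w) :
    Primrec fun a => feedAll (acc a) (trans a) (M a) (x a) (w a) := by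
  refine Primrec.list_foldl (h := fun a z => z.1.flatMap fun x =>
    feed (acc a) (trans a) (M a) x z.2) hw (Primrec.list_cons.comp hx (.const [])) ?_
  refine Primrec.list_flatMap (.comp .fst .snd) ?_
  exact primrec_feed (hacc.comp (.comp .fst .fst)) (htrans.comp (.comp .fst .fst))
    (hM.comp (.comp .fst .fst)) .snd (.comp .snd (.comp .snd .fst))

theorem primrec_numRegs {cf : α → NRTCode B C} {cg : α → NRTCode A B} (hf : Primrec cf)
    (hg : Primrec cg) : Primrec fun a => numRegs (cf a) (cg a) :=
  Primrec.succ.comp (Primrec.nat_add.comp (primrec_sum (.comp .fst (.comp .snd hf)))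
    (primrec_sum (.comp .fst (.comp .snd hg))))

theorem primrec_pairStates {cf : α → NRTCode B C} {cg : α → NRTCode A B} (hf : Primrec cf)
    (hg : Primrec cg) : Primrec fun a => pairStates (cf a) (cg a) := by
  have hN := Primrec.nat_double.comp (primrec_numRegs hf hg)
  refine Primrec.list_flatMap (.comp .fst hg) (Primrec.list_flatMap (.comp .fst (hf.comp .fst))
    (Primrec.list_flatMap ((primrec_tuples (.comp .succ hN) hN).comp (.comp .fst .fst))
    (Primrec.list_flatMap (.const _) (Primrec.list_flatMap (.const _) (Primrec.list_map (.const _)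
      (Primrec.pair (.pair ?_ ?_) (.pair ?_ (.pair ?_ (.pair ?_ ?_)))))))))
  · exact .comp .snd (.comp .fst (.comp .fst (.comp .fst (.comp .fst .fst))))
  · exact .comp .snd (.comp .fst (.comp .fst (.comp .fst .fst)))
  · exact .comp .snd (.comp .fst (.comp .fst .fst))
  · exact .comp .snd (.comp .fst .fst)
  · exact .comp .snd .fst
  · exact .snd

theorem primrec_innerLocs {N p : α → ℕ} {s : α → PairState} {k : α → TransitionCode A B}
    (hN : Primrec N) (hp : Primrec p) (hs : Primrec s) (hk : Primrec k) :
    Primrec fun a => innerLocs (N a) (p a) (s a) (k a) :=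
  primrec_relocate 0 (Primrec.nat_double.comp hN) hp (.comp .fst (.comp .snd hs))
    (.comp .fst (.comp .snd (.comp .snd (.comp .snd hk))))

theorem primrec_pairSucc {gacc : α → List ℕ} {s : α → PairState} {k : α → TransitionCode A B}
    {x : α → Partial C} (ha : Primrec gacc) (hs : Primrec s) (hk : Primrec k) (hx : Primrec x) :
    Primrec fun a => pairSucc (gacc a) (s a) (k a) (x a) := by
  have htgt := Primrec.snd.comp (Primrec.snd.comp (Primrec.snd.comp (Primrec.snd.comp
    (Primrec.snd.comp hk))))
  have hx2 := Primrec.snd.comp (Primrec.snd.comp hx)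
  have hempty : PrimrecPred fun a => (x a).2.2.1 = [] :=
    (Primrec.eq.comp (Primrec.list_length.comp (Primrec.fst.comp hx2)) (.const 0)).of_eq
      fun a => by simp
  refine .pair (.pair htgt (.comp .fst hx)) (.pair (.comp .fst (.comp .snd hx)) ?_)
  exact (Primrec.dom_finite fun z : (Bool × Bool × Bool) × (Bool × Bool × Bool) =>
    raiseFlags z.1 z.2).comp (.pair (.comp .snd (.comp .snd hs))
      (.pair (primrec_mem htgt ha).decide
        (.pair (.comp .snd hx2) (Primrec.not.comp hempty.decide))))

theorem primrec_pairTrans {cf : α → NRTCode B C} {cg : α → NRTCode A B} {s : α → PairState}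
    {p : α → ℕ} {k : α → TransitionCode A B} (hf : Primrec cf) (hg : Primrec cg)
    (hs : Primrec s) (hp : Primrec p) (hk : Primrec k) :
    Primrec fun a => pairTrans (cf a) (cg a) (s a) (p a) (k a) := by
  have hN := primrec_numRegs hf hg
  have hm := Primrec.fst.comp (Primrec.snd.comp hs)
  have hf3 := Primrec.snd.comp (Primrec.snd.comp (Primrec.snd.comp hf))
  have hk2 := Primrec.snd.comp (Primrec.snd.comp hk)
  refine Primrec.ite (.and ?_ ?_) (Primrec.list_map ?_ ?_) (.const [])
  · exact Primrec.eq.comp (.comp .fst hk) (.comp .fst (.comp .fst hs))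
  · exact Primrec.eq.comp (primrec_staticTest 0 hp hm (.comp .fst hk2)) (.const true)
  · refine primrec_feedAll (.comp .fst hf3) (.comp .snd hf3) (Primrec.nat_double.comp hN)
      (.pair (.comp .snd (.comp .fst hs)) (.pair (primrec_innerLocs hN hp hs hk) (.const _)))
      (.comp .fst (.comp .snd (.comp .snd hk2)))
  · refine Primrec.pair (Primrec.encode.comp (hs.comp .fst))
      (.pair (.comp .fst (.comp .snd (hk.comp .fst)))
      (.pair ((primrec_poolTest hp hm).comp .fst) (.pair
        (Primrec.list_cons.comp (hp.comp .fst) (.const []))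
        (.pair (.comp .fst (.comp .snd (.comp .snd .snd))) (Primrec.encode.comp ?_)))))
    exact primrec_pairSucc (.comp .fst (.comp .snd (.comp .snd (.comp .snd (hg.comp .fst)))))
      (hs.comp .fst) (hk.comp .fst) .snd

theorem primrec_compose : Primrec₂ (compose : NRTCode B C → NRTCode A B → NRTCode A C) := by
  have hf : Primrec fun a : NRTCode B C × NRTCode A B => a.1 := .fst
  have hg : Primrec fun a : NRTCode B C × NRTCode A B => a.2 := .snd
  have hN := Primrec.nat_double.comp (primrec_numRegs hf hg)
  have hS := primrec_pairStates hf hg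
  have hr := Primrec.list_range.comp (Primrec.succ.comp hN)
  refine Primrec.pair (Primrec.list_map hS (Primrec.encode.comp .snd))
    (.pair hr (.pair ?_ (.pair ?_ ?_)))
  · refine Primrec.encode.comp (.pair (.pair (.comp .fst (.comp .snd (.comp .snd hg)))
      (.comp .fst (.comp .snd (.comp .snd hf)))) (.pair ?_ (.const _)))
    exact Primrec.list_map (Primrec.list_range.comp hN) (.const 0)
  · refine Primrec.list_flatMap hS (Primrec.ite (Primrec.eq.comp
      ((Primrec.dom_finite allFlags).comp (.comp .snd (.comp .snd .snd))) (.const true))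
      (Primrec.list_cons.comp (Primrec.encode.comp .snd) (.const [])) (.const []))
  · refine Primrec.list_flatMap hS (Primrec.list_flatMap (hr.comp .fst) (Primrec.list_flatMap
      (.comp .snd (.comp .snd (.comp .snd (.comp .snd (.comp .snd (.comp .fst .fst)))))) ?_))
    exact primrec_pairTrans (.comp .fst (.comp .fst (.comp .fst .fst)))
      (.comp .snd (.comp .fst (.comp .fst .fst))) (.comp .snd (.comp .fst .fst))
      (.comp .snd .fst) .snd

end Primrec

end NRTCode

/-! ### Runs of codes -/

theorem evalSymbol_foldl_congr {a b : ℕ → Bool} {l : List (ℕ × ℕ)} (h : ∀ s ∈ l, a s.2 = b s.2)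
    (st : List Bool) : l.foldl (evalSymbol a) st = l.foldl (evalSymbol b) st := by
  induction l generalizing st with
  | nil => rfl
  | cons s l ih =>
    have hs : evalSymbol a st s = evalSymbol b st s := by
      simp [evalSymbol, h s (by simp)]
    rw [List.foldl_cons, List.foldl_cons, hs, ih fun s hs => h s (by simp [hs])]

theorem evalPostfix_congr {a b : ℕ → Bool} {l : List (ℕ × ℕ)} (h : ∀ s ∈ l, a s.2 = b s.2) :
    evalPostfix a l = evalPostfix b l := by
  rw [evalPostfix, evalPostfix, evalSymbol_foldl_congr h]

open Classical in
-- The arbitrary stack `st` makes the induction work: the second operand of a connective is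
-- evaluated on top of the value of the first.
theorem RegTest.foldl_postfix {R D : Type*} (ν : R → ℕ) (τ : ℕ → D) (d : D) (φ : RegTest R) :
    ∃ b : Bool, (b = true ↔ φ.Sat (fun r => τ (ν r)) d) ∧ ∀ st,
      (φ.postfix ν).foldl (evalSymbol fun r => decide (τ r = d)) st = b :: st := by
  induction φ with
  | top => exact ⟨true, by simp [RegTest.Sat], fun st => rfl⟩
  | bot => exact ⟨false, by simp [RegTest.Sat], fun st => rfl⟩
  | eq r => exact ⟨decide (τ (ν r) = d), by simp [RegTest.Sat], fun st => rfl⟩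
  | ne r => exact ⟨!decide (τ (ν r) = d), by simp [RegTest.Sat], fun st => rfl⟩
  | and φ ψ h1 h2 =>
    obtain ⟨b, hb, h1⟩ := h1
    obtain ⟨c, hc, h2⟩ := h2
    refine ⟨b && c, by simp [RegTest.Sat, hb, hc], fun st => ?_⟩
    simp [RegTest.postfix, List.foldl_append, h1, h2, evalSymbol]
  | or φ ψ h1 h2 =>
    obtain ⟨b, hb, h1⟩ := h1
    obtain ⟨c, hc, h2⟩ := h2
    refine ⟨b || c, by simp [RegTest.Sat, hb, hc], fun st => ?_⟩
    simp [RegTest.postfix, List.foldl_append, h1, h2, evalSymbol]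
  | not φ h =>
    obtain ⟨b, hb, h⟩ := h
    refine ⟨!b, by simp [RegTest.Sat, ← hb], fun st => ?_⟩
    simp [RegTest.postfix, List.foldl_append, h, evalSymbol]

open Classical in
theorem RegTest.evalPostfix_postfix {R D : Type*} (ν : R → ℕ) (τ : ℕ → D) (d : D)
    (φ : RegTest R) : evalPostfix (fun r => decide (τ r = d)) (φ.postfix ν) = true ↔
      φ.Sat (fun r => τ (ν r)) d := by
  obtain ⟨b, hb, h⟩ := φ.foldl_postfix ν τ d
  simp [evalPostfix, h, hb]

/-- A transition taken in a configuration on a labelled datum, at the level of codes. -/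
structure Firing (A B D : Type*) where
  code : TransitionCode A B
  src : ℕ × (ℕ → D)
  inp : A × D

namespace Firing

variable {A B D : Type*}

/-- The configuration reached. -/
def tgt (e : Firing A B D) : ℕ × (ℕ → D) :=
  (e.code.2.2.2.2.2, fun r => if r ∈ e.code.2.2.2.1 then e.inp.2 else e.src.2 r)

/-- The word written. -/
def out (e : Firing A B D) : List (B × D) :=
  e.code.2.2.2.2.1.map fun x => (x.1, e.tgt.2 x.2)

open Classical in
/-- The transition is one of `trans` and can be taken. -/
def Valid (trans : List (TransitionCode A B)) (e : Firing A B D) : Prop :=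
  e.code ∈ trans ∧ e.code.1 = e.src.1 ∧ e.code.2.1 = e.inp.1 ∧
    evalPostfix (fun r => decide (e.src.2 r = e.inp.2)) e.code.2.2.1 = true

end Firing

namespace NRTCode

open Filter

variable {A B D : Type*}

/-- Accepting runs of codes. -/
structure AccRun (d₀ : D) (c : NRTCode A B) (e : ℕ → Firing A B D) : Prop where
  valid : ∀ n, (e n).Valid c.2.2.2.2
  link : ∀ n, (e n).tgt = (e (n + 1)).src
  init : (e 0).src = (c.2.2.1, fun _ => d₀)
  acc : ∃ᶠ n in atTop, (e n).tgt.1 ∈ c.2.2.2.1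

theorem Codes.exists_accRun {d₀ : D} {c : NRTCode A B} {T : NRT A B} (hc : c.Codes T)
    {ρ : T.Run D} (hρ : ρ.Accepting d₀) :
    ∃ e : ℕ → Firing A B D, AccRun d₀ c e ∧ (∀ n, (e n).inp = ρ.input n) ∧
      ∀ n, (e n).out = ρ.output n := by
  classical
  obtain ⟨states, registers, init, accepting, transitions⟩ := c
  obtain ⟨νQ, νR, hQ, hR, hsts, hregs, hinit, hacc, ht, hk⟩ := hc
  choose t htT hsrc htgt hlet hsat hasg hnasg hout using ρ.step
  choose k hkm hkc using fun n => ht (t n) (htT n)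
  -- Numbers that name no register get `d₀`, so that the initial valuation is constant; no
  -- transition ever assigns them.
  let val : (T.R → D) → ℕ → D := fun τ => Function.extend νR τ fun _ => d₀
  have hval (τ : T.R → D) (r : T.R) : val τ (νR r) = τ r := hR.extend_apply _ _ _
  let e : ℕ → Firing A B D := fun n =>
    ⟨k n, (νQ (ρ.config n).1, val (ρ.config n).2), ρ.input n⟩
  have hlink (n : ℕ) : (e n).tgt = (e (n + 1)).src := by
    obtain ⟨h1, h2, h3, h4, h5, h6⟩ := hkc n
    refine Prod.ext ?_ (funext fun r => ?_)
    · exact h6.trans (congrArg νQ (htgt n))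
    · change (if r ∈ (k n).2.2.2.1 then (ρ.input n).2 else val (ρ.config n).2 r) =
        val (ρ.config (n + 1)).2 r
      by_cases hr : ∃ x, νR x = r
      · obtain ⟨x, rfl⟩ := hr
        rw [hval, hval]
        by_cases hx : x ∈ (t n).asgn
        · rw [if_pos ((h4 _).mpr ⟨x, hx, rfl⟩), hasg n x hx]
        · rw [if_neg, hnasg n x hx]
          intro hmem
          obtain ⟨y, hy, hxy⟩ := (h4 _).mp hmem
          exact hx (hR hxy ▸ hy)
      · rw [if_neg fun hmem => hr ?_]
        · simp [val, Function.extend_apply' _ _ _ hr]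
        · obtain ⟨y, -, hy⟩ := (h4 _).mp hmem
          exact ⟨y, hy⟩
  refine ⟨e, ⟨fun n => ?_, hlink, ?_, ?_⟩, fun _ => rfl, fun n => ?_⟩
  · obtain ⟨h1, h2, h3, h4, h5, h6⟩ := hkc n
    refine ⟨hkm n, h1.trans (congrArg νQ (hsrc n)), h2.trans (hlet n), ?_⟩
    change evalPostfix (fun r => decide (val (ρ.config n).2 r = (ρ.input n).2)) (k n).2.2.1 = true
    have h3' : (k n).2.2.1 = (t n).test.postfix νR := h3
    rw [h3', RegTest.evalPostfix_postfix]
    simpa [hval] using hsat n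
  · change (νQ (ρ.config 0).1, val (ρ.config 0).2) = (init, fun _ => d₀)
    rw [hρ.1, hinit]
    refine Prod.ext rfl (funext fun r => ?_)
    by_cases hr : ∃ x, νR x = r
    · obtain ⟨x, rfl⟩ := hr
      exact hval _ _
    · change val (fun _ => d₀) r = d₀
      exact Function.extend_apply' _ _ _ hr
  · obtain ⟨q, hq, hfreq⟩ := hρ.2
    rw [frequently_atTop] at hfreq ⊢
    intro N
    -- Acceptance of firings looks at the target, which is the configuration one index later.
    obtain ⟨n, hn, rfl⟩ := hfreq (N + 1)
    refine ⟨n - 1, by omega, ?_⟩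
    rw [hlink, Nat.sub_add_cancel (by omega)]
    exact (hacc _).mpr ⟨_, hq, rfl⟩
  · obtain ⟨h1, h2, h3, h4, h5, h6⟩ := hkc n
    rw [hout n, Firing.out, hlink]
    change (k n).2.2.2.2.1.map (fun x => (x.1, val (ρ.config (n + 1)).2 x.2)) = _
    have h5' : (k n).2.2.2.2.1 = (t n).out.map fun x => (x.1, νR x.2) := h5
    rw [h5', List.map_map]
    simp [Function.comp_def, hval]

theorem Codes.exists_run {d₀ : D} {c : NRTCode A B} {T : NRT A B} (hc : c.Codes T)
    {e : ℕ → Firing A B D} (he : AccRun d₀ c e) :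
    ∃ ρ : T.Run D, ρ.Accepting d₀ ∧ (∀ n, ρ.input n = (e n).inp) ∧
      ∀ n, ρ.output n = (e n).out := by
  classical
  obtain ⟨states, registers, init, accepting, transitions⟩ := c
  obtain ⟨νQ, νR, hQ, hR, hsts, hregs, hinit, hacc, ht, hk⟩ := hc
  choose t htT htc using fun n => hk _ (he.valid n).1
  -- A firing carries only a number; it names a state of `T` because it is the initial state or the
  -- target of the preceding transition.
  have hsrc (n : ℕ) : ∃ q : T.Q, νQ q = (e n).src.1 ∧ (n = 0 → q = T.init) := by
    cases n with
    | zero => exact ⟨T.init, by rw [he.init]; exact hinit.symm, fun _ => rfl⟩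
    | succ n =>
      refine ⟨(t n).tgt, ?_, by simp⟩
      rw [← he.link]
      exact (htc n).2.2.2.2.2.symm
  choose q hq hq0 using hsrc
  let cfg : ℕ → T.Config D := fun n => (q n, fun r => (e n).src.2 (νR r))
  have hsucc (n : ℕ) (r : T.R) : (e (n + 1)).src.2 (νR r) =
      if r ∈ (t n).asgn then (e n).inp.2 else (e n).src.2 (νR r) := by
    rw [← he.link]
    obtain ⟨h1, h2, h3, h4, h5, h6⟩ := htc n
    change (if νR r ∈ (e n).code.2.2.2.1 then _ else _) = _
    have : νR r ∈ (e n).code.2.2.2.1 ↔ r ∈ (t n).asgn :=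
      (h4 _).trans ⟨fun ⟨x, hx, hxr⟩ => hR hxr ▸ hx, fun h => ⟨r, h, rfl⟩⟩
    simp [this]
  refine ⟨⟨cfg, fun n => (e n).inp, fun n => (e n).out, fun n => ?_⟩, ⟨?_, ?_⟩, fun _ => rfl,
    fun _ => rfl⟩
  · obtain ⟨v1, v2, v3, v4⟩ := he.valid n
    obtain ⟨h1, h2, h3, h4, h5, h6⟩ := htc n
    refine ⟨t n, htT n, ?_, ?_, ?_, ?_, ?_, ?_, ?_⟩
    · exact hQ (h1.symm.trans (v2.trans (hq n).symm))
    · refine hQ (Eq.trans h6.symm ?_)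
      rw [hq, ← he.link]
      rfl
    · exact h2.symm.trans v3
    · have h3' : (e n).code.2.2.1 = (t n).test.postfix νR := h3
      rw [h3', RegTest.evalPostfix_postfix] at v4
      exact v4
    · intro r hr
      exact (hsucc n r).trans (if_pos hr)
    · intro r hr
      exact (hsucc n r).trans (if_neg hr)
    · have h5' : (e n).code.2.2.2.2.1 = (t n).out.map fun x => (x.1, νR x.2) := h5
      rw [Firing.out, h5', List.map_map, he.link]
      rfl
  · refine Prod.ext (hq0 0 rfl) (funext fun r => ?_)
    change (e 0).src.2 (νR r) = d₀
    rw [he.init]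
  · have hT := T.finite_Q
    have hf : ∃ᶠ n in atTop, ∃ x ∈ T.accepting, q n = x := by
      have := he.acc
      rw [frequently_atTop] at this ⊢
      intro N
      obtain ⟨n, hn, hmem⟩ := this N
      obtain ⟨x, hx, hxq⟩ := (hacc _).mp hmem
      refine ⟨n + 1, by omega, x, hx, hQ ?_⟩
      rw [hq, hxq, he.link]
    -- Pigeonhole: among finitely many accepting states, one recurs.
    exact (frequently_exists_finite (Set.toFinite T.accepting)).mp hf

/-- The right-hand side mentions only the code, so the composition can be studied entirely at the
level of codes. -/
theorem Codes.mem_rel_iff {d₀ : D} {c : NRTCode A B} {T : NRT A B} (hc : c.Codes T)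
    {x : DataWord A D} {z : DataWord B D} :
    (x, z) ∈ T.rel d₀ ↔ ∃ e : ℕ → Firing A B D, AccRun d₀ c e ∧ (∀ n, (e n).inp = x n) ∧
      HasConcat (fun n => (e n).out) z := by
  constructor
  · rintro ⟨ρ, hρ, rfl, hz⟩
    obtain ⟨e, he, hi, ho⟩ := hc.exists_accRun hρ
    refine ⟨e, he, hi, ?_⟩
    rw [funext ho]
    exact hz
  · rintro ⟨e, he, hi, hz⟩
    obtain ⟨ρ, hρ, hi', ho⟩ := hc.exists_run he
    refine ⟨ρ, hρ, funext fun n => (hi' n).trans (hi n), ?_⟩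
    rw [← funext ho] at hz
    exact hz

theorem Codes.infiniteOutputs {d₀ : D} {c : NRTCode A B} {T : NRT A B} (hc : c.Codes T)
    (h : ∀ e : ℕ → Firing A B D, AccRun d₀ c e → ∃ᶠ n in atTop, (e n).out ≠ []) :
    T.InfiniteOutputs d₀ := by
  intro ρ hρ
  obtain ⟨e, he, -, ho⟩ := hc.exists_accRun hρ
  have := infinite_concat_iff.mpr (h e he)
  rw [funext ho] at this
  exact this

/-- The facts about codes of transducers that the composition depends on. -/
structure Bounded (N : ℕ) (c : NRTCode A B) : Prop where
  init : c.2.2.1 ∈ c.1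
  tgt : ∀ k ∈ c.2.2.2.2, k.2.2.2.2.2 ∈ c.1
  test : ∀ k ∈ c.2.2.2.2, ∀ s ∈ k.2.2.1, s.2 < N
  out : ∀ k ∈ c.2.2.2.2, ∀ x ∈ k.2.2.2.2.1, x.2 < N

/-- Constants and connectives carry the dummy register `0`. A strict bound on all second components
must therefore be positive, which explains the `+ 1` in `numRegs`. -/
theorem _root_.RegTest.postfix_mem {R : Type*} (ν : R → ℕ) (φ : RegTest R) :
    ∀ s ∈ φ.postfix ν, s.2 = 0 ∨ ∃ r, s.2 = ν r := by
  intro s hs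
  induction φ with
  | and φ ψ h1 h2 | or φ ψ h1 h2 =>
    simp only [RegTest.postfix, List.mem_append, List.mem_singleton] at hs
    rcases hs with (h | h) | rfl
    exacts [h1 h, h2 h, Or.inl rfl]
  | not φ h =>
    simp only [RegTest.postfix, List.mem_append, List.mem_singleton] at hs
    rcases hs with h' | rfl
    exacts [h h', Or.inl rfl]
  | _ => simp_all [RegTest.postfix]

theorem Codes.bounded {N : ℕ} {c : NRTCode A B} {T : NRT A B} (hc : c.Codes T)
    (hN : c.2.1.sum < N) : c.Bounded N := by
  obtain ⟨states, registers, init, accepting, transitions⟩ := c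
  obtain ⟨νQ, νR, hQ, hR, hsts, hregs, hinit, hacc, ht, hk⟩ := hc
  have hlt (r : T.R) : νR r < N :=
    (List.le_sum_of_mem ((hregs _).mpr ⟨r, trivial, rfl⟩)).trans_lt hN
  have hst (q : T.Q) : νQ q ∈ states := (hsts _).mpr ⟨q, trivial, rfl⟩
  refine ⟨hinit ▸ hst _, fun k hkm => ?_, fun k hkm s hs => ?_, fun k hkm x hx => ?_⟩ <;>
    obtain ⟨t, -, h1, h2, h3, h4, h5, h6⟩ := hk k hkm
  · exact h6 ▸ hst _
  · change k.2.2.1 = _ at h3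
    rw [h3] at hs
    rcases RegTest.postfix_mem νR _ s hs with h | ⟨r, h⟩
    · omega
    · exact h ▸ hlt r
  · change k.2.2.2.2.1 = _ at h5
    rw [h5, List.mem_map] at hx
    obtain ⟨y, -, rfl⟩ := hx
    exact hlt _

/-- Conditions for a code to be a code of a transducer. -/
theorem exists_codes_of_mem {states registers : List ℕ} {init : ℕ} {accepting : List ℕ}
    {transitions : List (TransitionCode A B)} (hi : init ∈ states)
    (ha : ∀ q ∈ accepting, q ∈ states)
    (ht : ∀ k ∈ transitions, k.1 ∈ states ∧ k.2.2.2.2.2 ∈ states ∧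
      (∃ φ : RegTest {r // r ∈ registers}, k.2.2.1 = φ.postfix Subtype.val) ∧
      (∀ r ∈ k.2.2.2.1, r ∈ registers) ∧ ∀ x ∈ k.2.2.2.2.1, x.2 ∈ registers) :
    ∃ T : NRT A B, Codes (states, registers, init, accepting, transitions) T := by
  have hex (k : {k // k ∈ transitions}) :
      ∃ t : RegTransition A B {q // q ∈ states} {r // r ∈ registers},
        TransitionCode.Codes Subtype.val Subtype.val k.1 t := by
    obtain ⟨⟨src, letter, test, asgn, out, tgt⟩, hk⟩ := k
    obtain ⟨h1, h2, ⟨φ, h3⟩, h4, h5⟩ := ht _ hk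
    refine ⟨⟨⟨src, h1⟩, letter, φ, {r | r.1 ∈ asgn},
      out.pmap (fun x hx => (x.1, ⟨x.2, hx⟩)) h5, ⟨tgt, h2⟩⟩, rfl, rfl, h3, ?_, ?_, rfl⟩
    · intro n
      constructor
      · exact fun h => ⟨⟨n, h4 n h⟩, h, rfl⟩
      · rintro ⟨r, hr, rfl⟩
        exact hr
    · simp [List.map_pmap]
  choose t htc using hex
  have hfin : Finite {k // k ∈ transitions} := transitions.finite_toSet
  refine ⟨⟨{q // q ∈ states}, {r // r ∈ registers}, inferInstance, inferInstance, ⟨init, hi⟩,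
    {q | q.1 ∈ accepting}, Set.range t, Set.finite_range t⟩, Subtype.val, Subtype.val,
    Subtype.val_injective, Subtype.val_injective, ?_, ?_, rfl, ?_, ?_, ?_⟩
  · intro n
    simp
  · intro n
    simp
  · intro n
    constructor
    · exact fun h => ⟨⟨n, ha n h⟩, h, rfl⟩
    · rintro ⟨r, hr, rfl⟩
      exact hr
  · rintro _ ⟨k, rfl⟩
    exact ⟨k.1, k.2, htc k⟩
  · exact fun k hk => ⟨_, ⟨⟨k, hk⟩, rfl⟩, htc ⟨k, hk⟩⟩

/-! ### Location lists and static tests -/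

section Locations

theorem length_relocate (M e p : ℕ) (m asgn : List ℕ) : (relocate M e p m asgn).length = M := by
  simp [relocate]

theorem getD_relocate {M e p i : ℕ} {m asgn : List ℕ} (hi : i < M) :
    (relocate M e p m asgn).getD i 0 = if i % 2 = e ∧ i / 2 ∈ asgn then p else m.getD i 0 := by
  simp [relocate, List.getD_eq_getElem?_getD, hi]

theorem getD_mem_of_lt {m : List ℕ} {i : ℕ} (h : i < m.length) : m.getD i 0 ∈ m := by
  simp [List.getD_eq_getElem?_getD, h]

/-- A location list for registers with names below `N`, with locations in `S`. -/
structure LocList (N : ℕ) (S : Set ℕ) (m : List ℕ) : Prop where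
  length : m.length = 2 * N
  mem : ∀ x ∈ m, x ∈ S

theorem LocList.getD_mem {N : ℕ} {S : Set ℕ} {m : List ℕ} (h : LocList N S m) {e r : ℕ}
    (he : e < 2) (hr : r < N) : m.getD (2 * r + e) 0 ∈ S :=
  h.mem _ (getD_mem_of_lt (by have := h.length; omega))

theorem LocList.relocate {N : ℕ} {S : Set ℕ} {m : List ℕ} (h : LocList N S m) (e : ℕ) {p : ℕ}
    (hp : p ∈ S) (asgn : List ℕ) : LocList N S (relocate (2 * N) e p m asgn) := by
  refine ⟨length_relocate _ _ _ _ _, fun x hx => ?_⟩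
  simp only [NRTCode.relocate, List.mem_map, List.mem_range] at hx
  obtain ⟨i, hi, rfl⟩ := hx
  split_ifs
  · exact hp
  · exact h.mem _ (getD_mem_of_lt (by have := h.length; omega))

variable {D : Type*}

/-- The valuation `τ` of the inner (`e = 0`) or outer (`e = 1`) transducer is found in the pool `v`
at the locations `m`. -/
def Represents (e N : ℕ) (m : List ℕ) (v τ : ℕ → D) : Prop :=
  ∀ r < N, τ r = v (m.getD (2 * r + e) 0)

/-- Assigning the datum in `p` only redirects locations to `p`; the pool `v` is untouched. The
parity of the index separates the two transducers, hence the companion lemma for `e ≠ e'`. -/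
theorem Represents.relocate {e N : ℕ} {m : List ℕ} {v τ : ℕ → D} (h : Represents e N m v τ)
    (he : e < 2) (p : ℕ) (asgn : List ℕ) :
    Represents e N (relocate (2 * N) e p m asgn) v fun r => if r ∈ asgn then v p else τ r := by
  intro r hr
  rw [getD_relocate (by omega), show (2 * r + e) % 2 = e by omega,
    show (2 * r + e) / 2 = r by omega]
  by_cases hra : r ∈ asgn
  · simp [hra]
  · simpa [hra] using h r hr

theorem Represents.relocate_of_ne {e e' N : ℕ} {m : List ℕ} {v τ : ℕ → D}
    (h : Represents e N m v τ) (he : e < 2) (hne : e ≠ e') (p : ℕ) (asgn : List ℕ) :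
    Represents e N (NRTCode.relocate (2 * N) e' p m asgn) v τ := by
  intro r hr
  rw [getD_relocate (by omega), if_neg (by omega)]
  exact h r hr

open Classical in
-- Since `v` is injective on the locations concerned, two data are equal exactly when their
-- locations are.
theorem Represents.staticTest_eq {e N p : ℕ} {m : List ℕ} {v τ : ℕ → D} {S : Set ℕ}
    (h : Represents e N m v τ) (he : e < 2) (hm : LocList N S m) (hv : Set.InjOn v S) (hp : p ∈ S)
    {test : List (ℕ × ℕ)} (ht : ∀ s ∈ test, s.2 < N) :
    staticTest e p m test = evalPostfix (fun r => decide (τ r = v p)) test := by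
  refine evalPostfix_congr fun s hs => ?_
  rw [h _ (ht s hs), Bool.eq_iff_iff, beq_iff_eq, decide_eq_true_iff]
  exact (hv.eq_iff (hm.getD_mem he (ht s hs)) hp).symm

theorem mem_tuples {n M : ℕ} {l : List ℕ} :
    l ∈ tuples n M ↔ l.length = M ∧ ∀ x ∈ l, x < n := by
  induction M generalizing l with
  | zero => cases l <;> simp [tuples]
  | succ M ih =>
    change l ∈ (tuples n M).flatMap _ ↔ _
    simp only [List.mem_flatMap, List.mem_map, List.mem_range, ih]
    constructor
    · rintro ⟨t, ⟨h1, h2⟩, p, hp, rfl⟩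
      simpa [h1, hp] using h2
    · rintro ⟨h1, h2⟩
      cases l with
      | nil => simp at h1
      | cons p t =>
        simp only [List.length_cons, Nat.add_right_cancel_iff, List.mem_cons, forall_eq_or_imp]
          at h1 h2
        exact ⟨t, ⟨h1, h2.2⟩, p, h2.1, rfl⟩

end Locations

/-! ### The test that verifies the guessed pool register -/

section Pool

theorem exists_postfix_eq_poolTest {S : List ℕ} {p : ℕ} {m : List ℕ} (hp : p ∈ S)
    (hm : ∀ q ∈ m, q ∈ S) :
    ∃ φ : RegTest {r // r ∈ S}, poolTest p m = φ.postfix Subtype.val := by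
  rw [poolTest]
  split_ifs with hpm
  · exact ⟨.eq ⟨p, hp⟩, rfl⟩
  · clear hpm
    -- The conjunction is built from the left, so the induction needs an arbitrary first conjunct
    -- `ψ`.
    suffices ∀ ψ : RegTest {r // r ∈ S}, ∃ φ : RegTest {r // r ∈ S},
        ψ.postfix Subtype.val ++ (m.flatMap fun q => [(6, q), (2, 0)]) =
          φ.postfix Subtype.val from this .top
    induction m with
    | nil => exact fun ψ => ⟨ψ, by simp⟩
    | cons q m ih =>
      intro ψ
      obtain ⟨φ, hφ⟩ := ih (fun q hq => hm q (by simp [hq])) (.and ψ (.ne ⟨q, hm q (by simp)⟩))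
      exact ⟨φ, by rw [← hφ]; simp [RegTest.postfix]⟩

theorem evalPostfix_poolTest (a : ℕ → Bool) (p : ℕ) (m : List ℕ) :
    evalPostfix a (poolTest p m) = true ↔
      if p ∈ m then a p = true else ∀ q ∈ m, a q = false := by
  rw [poolTest]
  split_ifs with hpm
  · simp [evalPostfix, evalSymbol]
  · clear hpm
    suffices ∀ b, (m.flatMap fun q => [(6, q), (2, 0)]).foldl (evalSymbol a) [b] =
        [b && m.all fun q => !a q] by
      have := this true
      simp_all [evalPostfix, evalSymbol]
    induction m with
    | nil => simp
    | cons q m ih =>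
      intro b
      rw [List.flatMap_cons, List.foldl_append]
      simp [evalSymbol, ih, Bool.and_assoc]

theorem exists_fresh {m : List ℕ} {n : ℕ} (h : m.length < n) : ∃ p < n, p ∉ m := by
  by_contra! hc
  have h1 : Finset.range n ⊆ m.toFinset := fun p hp => by simpa using hc p (by simpa using hp)
  have h2 := Finset.card_le_card h1
  have h3 := m.toFinset_card_le
  rw [Finset.card_range] at h2
  omega

end Pool

/-! ### Simulating the outer transducer on a finite word -/

section Feed

variable {B C D : Type*}

/-- A finite sequence of consecutive firings. -/
def IsPath (trans : List (TransitionCode B C)) :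
    ℕ × (ℕ → D) → List (Firing B C D) → ℕ × (ℕ → D) → Prop
  | c, [], c' => c = c'
  | c, e :: es, c' => e.src = c ∧ e.Valid trans ∧ IsPath trans e.tgt es c'

theorem mem_feed [Encodable B] {acc : List ℕ} {trans : List (TransitionCode B C)} {M : ℕ} {x x' : Partial C}
    {y : B × ℕ} : x' ∈ feed acc trans M x y ↔ ∃ k ∈ trans, k.1 = x.1 ∧ k.2.1 = y.1 ∧
      staticTest 1 (x.2.1.getD (2 * y.2 + 0) 0) x.2.1 k.2.2.1 = true ∧
      x' = advance acc M (x.2.1.getD (2 * y.2 + 0) 0) x k := by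
  simp only [feed, List.mem_flatMap]
  refine exists_congr fun k => and_congr_right fun _ => ?_
  split_ifs with h
  · rw [List.mem_singleton]
    exact ⟨fun h' => ⟨h.1.1, Encodable.encode_injective h.1.2, h.2, h'⟩, fun h' => h'.2.2.2⟩
  · simp only [List.not_mem_nil, false_iff]
    exact fun h' => h ⟨⟨h'.1, congrArg _ h'.2.1⟩, h'.2.2.1⟩

/-- The choices made from distinct starting points are independent. This gives `feedAll` its
recursion on the first letter. -/
theorem mem_foldl_flatMap {X Y : Type*} (f : X → Y → List X) {w : List Y} {L : List X} {z : X} :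
    z ∈ w.foldl (fun L y => L.flatMap fun x => f x y) L ↔
      ∃ x ∈ L, z ∈ w.foldl (fun L y => L.flatMap fun x => f x y) [x] := by
  induction w generalizing L with
  | nil => simp
  | cons y w ih =>
    simp only [List.foldl_cons]
    rw [ih]
    simp only [List.mem_flatMap]
    constructor
    · rintro ⟨x', ⟨x, hx, hx'⟩, hz⟩
      exact ⟨x, hx, ih.mpr ⟨x', by simpa using hx', hz⟩⟩
    · rintro ⟨x, hx, hz⟩
      obtain ⟨x', hx', hz⟩ := ih.mp hz
      exact ⟨x', ⟨x, hx, by simpa using hx'⟩, hz⟩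

theorem feedAll_nil [Encodable B] (acc : List ℕ) (trans : List (TransitionCode B C)) (M : ℕ) (x : Partial C) :
    feedAll acc trans M x [] = [x] := rfl

theorem mem_feedAll_cons [Encodable B] {acc : List ℕ} {trans : List (TransitionCode B C)} {M : ℕ}
    {x x' : Partial C} {y : B × ℕ} {w : List (B × ℕ)} :
    x' ∈ feedAll acc trans M x (y :: w) ↔
      ∃ x₁ ∈ feed acc trans M x y, x' ∈ feedAll acc trans M x₁ w := by
  rw [feedAll, List.foldl_cons, mem_foldl_flatMap (f := feed acc trans M)]
  simp [feedAll]

/-- The syntactic invariant of intermediate results. -/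
structure Partial.WellFormed (states : List ℕ) (N : ℕ) (S : Set ℕ) (x : Partial C) : Prop where
  state : x.1 ∈ states
  locs : LocList N S x.2.1
  out : ∀ y ∈ x.2.2.1, y.2 ∈ S

theorem Partial.WellFormed.advance {states : List ℕ} {N : ℕ} {S : Set ℕ} {x : Partial C}
    (h : x.WellFormed states N S) (acc : List ℕ) {p : ℕ} (hp : p ∈ S) {k : TransitionCode B C}
    (hk : k.2.2.2.2.2 ∈ states) (hout : ∀ y ∈ k.2.2.2.2.1, y.2 < N) :
    (advance acc (2 * N) p x k).WellFormed states N S := by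
  have hl := h.locs.relocate 1 hp k.2.2.2.1
  refine ⟨hk, hl, fun y hy => ?_⟩
  simp only [NRTCode.advance, List.mem_append, List.mem_map] at hy
  rcases hy with hy | ⟨y, hy, rfl⟩
  · exact h.out y hy
  · exact hl.getD_mem (by omega) (hout y hy)

/-- Purely syntactic and independent of any pool contents: the code of the composition must be well
formed also at transitions that no run uses. -/
theorem Partial.WellFormed.feedAll [Encodable B] {cf : NRTCode B C} {N : ℕ} {S : Set ℕ} (hcf : cf.Bounded N)
    (acc : List ℕ) {w : List (B × ℕ)} (hw : ∀ y ∈ w, y.2 < N) {x x' : Partial C}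
    (h : x.WellFormed cf.1 N S) (hx : x' ∈ feedAll acc cf.2.2.2.2 (2 * N) x w) :
    x'.WellFormed cf.1 N S := by
  induction w generalizing x with
  | nil =>
    rw [feedAll_nil, List.mem_singleton] at hx
    exact hx ▸ h
  | cons y w ih =>
    obtain ⟨x₁, h1, h2⟩ := mem_feedAll_cons.mp hx
    obtain ⟨k, hk, -, -, -, rfl⟩ := mem_feed.mp h1
    refine ih (fun y hy => hw y (by simp [hy])) (h.advance acc ?_ (hcf.tgt k hk) (hcf.out k hk)) h2
    exact h.locs.getD_mem (by omega) (hw y (by simp))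

/-- The intermediate result `x` represents the configuration `c` of the outer transducer, and the
valuation `τ` of the inner one. -/
structure Partial.Rep (N : ℕ) (S : Set ℕ) (v τ : ℕ → D) (x : Partial C) (c : ℕ × (ℕ → D)) :
    Prop where
  state : x.1 = c.1
  locs : LocList N S x.2.1
  inner : Represents 0 N x.2.1 v τ
  outer : Represents 1 N x.2.1 v c.2

/-- The output word of an intermediate result. -/
def Partial.word (v : ℕ → D) (x : Partial C) : List (C × D) := x.2.2.1.map fun y => (y.1, v y.2)

/-- The path `es` accounts for the difference between the intermediate results `x` and `x'`. -/
structure Partial.Tracks (acc : List ℕ) (v : ℕ → D) (x x' : Partial C) (es : List (Firing B C D)) :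
    Prop where
  word : x'.word v = x.word v ++ es.flatMap Firing.out
  visit : x'.2.2.2 = true ↔ x.2.2.2 = true ∨ ∃ e ∈ es, e.tgt.1 ∈ acc

theorem Partial.Tracks.refl (acc : List ℕ) (v : ℕ → D) (x : Partial C) :
    Partial.Tracks acc v x x ([] : List (Firing B C D)) := ⟨by simp, by simp⟩

theorem Partial.Tracks.cons {acc : List ℕ} {v : ℕ → D} {x x₁ x' : Partial C} {e : Firing B C D}
    {es : List (Firing B C D)} (h : Partial.Tracks acc v x x₁ [e])
    (h' : Partial.Tracks acc v x₁ x' es) : Partial.Tracks acc v x x' (e :: es) := by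
  refine ⟨?_, ?_⟩
  · rw [h'.word, h.word]
    simp
  · rw [h'.visit, h.visit]
    simp [or_assoc]

theorem Partial.Rep.advance {N : ℕ} {S : Set ℕ} {v τ : ℕ → D} {x : Partial C}
    {e : Firing B C D} (h : x.Rep N S v τ e.src) (acc : List ℕ) {p : ℕ} (hp : p ∈ S)
    (hd : e.inp.2 = v p) (hout : ∀ y ∈ e.code.2.2.2.2.1, y.2 < N) :
    (advance acc (2 * N) p x e.code).Rep N S v τ e.tgt ∧
      Partial.Tracks acc v x (NRTCode.advance acc (2 * N) p x e.code) [e] := by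
  have h1 : Represents 1 N (relocate (2 * N) 1 p x.2.1 e.code.2.2.2.1) v e.tgt.2 := by
    have := h.outer.relocate (by omega) p e.code.2.2.2.1
    rw [← hd] at this
    exact this
  refine ⟨⟨rfl, h.locs.relocate 1 hp _, h.inner.relocate_of_ne (by omega) (by omega) _ _, h1⟩,
    ⟨?_, ?_⟩⟩
  · simp only [word, NRTCode.advance, List.map_append, List.map_map, List.flatMap_cons,
      List.flatMap_nil, List.append_nil, Firing.out]
    congr 1
    refine List.map_congr_left fun y hy => ?_
    simp [h1 y.2 (hout y hy)]
  · simp [NRTCode.advance, Firing.tgt]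

/-- Soundness of the symbolic simulation. The inner valuation `τ` and the pool `v` stay fixed along
the word, so each letter's datum sits at a known location and a successful static test is a genuine
one. -/
theorem Partial.Rep.exists_path [Encodable B] {cf : NRTCode B C} {N : ℕ} {S : Set ℕ} {v τ : ℕ → D}
    (hcf : cf.Bounded N) (hv : Set.InjOn v S) (acc : List ℕ) {w : List (B × ℕ)}
    (hw : ∀ y ∈ w, y.2 < N) {x x' : Partial C} {c : ℕ × (ℕ → D)} (h : x.Rep N S v τ c)
    (hx : x' ∈ NRTCode.feedAll acc cf.2.2.2.2 (2 * N) x w) :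
    ∃ (es : List (Firing B C D)) (c' : ℕ × (ℕ → D)), IsPath cf.2.2.2.2 c es c' ∧
      es.map Firing.inp = w.map (fun y => (y.1, τ y.2)) ∧ x'.Rep N S v τ c' ∧
      Partial.Tracks acc v x x' es := by
  induction w generalizing x c with
  | nil =>
    rw [feedAll_nil, List.mem_singleton] at hx
    subst hx
    exact ⟨[], c, rfl, rfl, h, .refl _ _ _⟩
  | cons y w ih =>
    obtain ⟨x₁, h1, h2⟩ := mem_feedAll_cons.mp hx
    obtain ⟨k, hk, hk1, hk2, hk3, rfl⟩ := mem_feed.mp h1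
    have hy : y.2 < N := hw y (by simp)
    have hp := h.locs.getD_mem (e := 0) (by omega) hy
    let e : Firing B C D := ⟨k, c, (y.1, τ y.2)⟩
    have hd : e.inp.2 = v (x.2.1.getD (2 * y.2 + 0) 0) := h.inner _ hy
    obtain ⟨h3, h4⟩ := Partial.Rep.advance (e := e) h acc hp hd (hcf.out k hk)
    obtain ⟨es, c', h5, h6, h7, h8⟩ := ih (fun y hy => hw y (by simp [hy])) h3 h2
    refine ⟨e :: es, c', ⟨rfl, ⟨hk, hk1.trans h.state, hk2, ?_⟩, h5⟩, ?_, h7, h4.cons h8⟩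
    · rw [h.outer.staticTest_eq (by omega) h.locs hv hp (hcf.test k hk), ← hd] at hk3
      exact hk3
    · rw [List.map_cons, List.map_cons, h6]

/-- Completeness of the symbolic simulation, by the same equivalence between static and genuine
tests. -/
theorem Partial.Rep.exists_mem_feedAll [Encodable B] {cf : NRTCode B C} {N : ℕ} {S : Set ℕ} {v τ : ℕ → D}
    (hcf : cf.Bounded N) (hv : Set.InjOn v S) (acc : List ℕ) {w : List (B × ℕ)}
    (hw : ∀ y ∈ w, y.2 < N) {x : Partial C} {c c' : ℕ × (ℕ → D)} (h : x.Rep N S v τ c)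
    {es : List (Firing B C D)} (hes : IsPath cf.2.2.2.2 c es c')
    (hin : es.map Firing.inp = w.map fun y => (y.1, τ y.2)) :
    ∃ x' ∈ NRTCode.feedAll acc cf.2.2.2.2 (2 * N) x w, x'.Rep N S v τ c' ∧
      Partial.Tracks acc v x x' es := by
  induction w generalizing x c es with
  | nil =>
    rw [List.map_nil, List.map_eq_nil_iff] at hin
    subst hin
    exact ⟨x, by simp [feedAll_nil], (show c = c' from hes) ▸ h, .refl _ _ _⟩
  | cons y w ih =>
    cases es with
    | nil => simp at hin
    | cons e es =>
      rw [List.map_cons, List.map_cons, List.cons.injEq] at hin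
      obtain ⟨rfl, ⟨hk, hk1, hk2, hk3⟩, hes⟩ := hes
      have hy : y.2 < N := hw y (by simp)
      have hp := h.locs.getD_mem (e := 0) (by omega) hy
      have hd : e.inp.2 = v (x.2.1.getD (2 * y.2 + 0) 0) := by
        rw [hin.1]
        exact h.inner _ hy
      obtain ⟨h3, h4⟩ := h.advance acc hp hd (hcf.out _ hk)
      obtain ⟨x', h5, h6, h7⟩ := ih (fun y hy => hw y (by simp [hy])) h3 hes hin.2
      refine ⟨x', mem_feedAll_cons.mpr ⟨_, mem_feed.mpr ⟨_, hk, hk1.trans h.state.symm, ?_, ?_,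
        rfl⟩, h5⟩, h6, h4.cons h7⟩
      · rw [hk2, hin.1]
      · rw [h.outer.staticTest_eq (by omega) h.locs hv hp (hcf.test _ hk), ← hd]
        exact hk3

end Feed

/-! ### One step of the composition -/

section Simulation

variable {A B C D : Type*}

theorem mem_pairStates {cf : NRTCode B C} {cg : NRTCode A B} {s : PairState} :
    s ∈ pairStates cf cg ↔ s.1.1 ∈ cg.1 ∧ s.1.2 ∈ cf.1 ∧
      LocList (numRegs cf cg) (Set.Iio (2 * numRegs cf cg + 1)) s.2.1 := by
  obtain ⟨⟨qg, qf⟩, m, a, b, c⟩ := s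
  have hb (b : Bool) : b ∈ [false, true] := by cases b <;> simp
  have hm : LocList (numRegs cf cg) (Set.Iio (2 * numRegs cf cg + 1)) m ↔
      m ∈ tuples (2 * numRegs cf cg + 1) (2 * numRegs cf cg) := by
    rw [mem_tuples]
    exact ⟨fun h => ⟨h.1, h.2⟩, fun h => ⟨h.1, h.2⟩⟩
  rw [hm]
  simp only [pairStates, List.mem_flatMap, List.mem_map]
  constructor
  · rintro ⟨qg, hqg, qf, hqf, m, hm, a, -, b, -, c, -, h⟩
    cases h
    exact ⟨hqg, hqf, hm⟩
  · rintro ⟨hqg, hqf, hm⟩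
    exact ⟨qg, hqg, qf, hqf, m, hm, a, hb a, b, hb b, c, hb c, rfl⟩

/-- The configuration of the composition with state `s` and pool `v` represents the configurations
`g` of the inner and `f` of the outer transducer. -/
structure PairRep (cf : NRTCode B C) (cg : NRTCode A B) (s : PairState) (v : ℕ → D)
    (g f : ℕ × (ℕ → D)) : Prop where
  mem : s ∈ pairStates cf cg
  state : s.1 = (g.1, f.1)
  inner : Represents 0 (numRegs cf cg) s.2.1 v g.2
  outer : Represents 1 (numRegs cf cg) s.2.1 v f.2
  inj : Set.InjOn v {x | x ∈ s.2.1}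

/-- The datum `d` belongs in the register `p` of the pool `v`. -/
def Fits (m : List ℕ) (v : ℕ → D) (p : ℕ) (d : D) : Prop :=
  if p ∈ m then v p = d else ∀ q ∈ m, v q ≠ d

/-- The pool after `d` has been stored in `p`. -/
def store (v : ℕ → D) (p : ℕ) (d : D) : ℕ → D := fun r => if r ∈ [p] then d else v r

theorem store_self (v : ℕ → D) (p : ℕ) (d : D) : store v p d p = d := by simp [store]

/-- If `p` is in use it already holds `d`, and otherwise no location in use is overwritten. -/
theorem Fits.store_eq {m : List ℕ} {v : ℕ → D} {p : ℕ} {d : D} (h : Fits m v p d) {x : ℕ}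
    (hx : x ∈ m) : store v p d x = v x := by
  rw [store]
  split_ifs with hp
  · rw [List.mem_singleton] at hp
    subst hp
    rw [Fits, if_pos hx] at h
    exact h.symm
  · rfl

/-- The invariant survives the store: a used location that holds `d` can only be `p` itself. -/
theorem Fits.injOn_store {m : List ℕ} {v : ℕ → D} {p : ℕ} {d : D} (h : Fits m v p d)
    (hv : Set.InjOn v {x | x ∈ m}) : Set.InjOn (store v p d) {x | x ∈ m ∨ x = p} := by
  have key : ∀ x ∈ m, store v p d x = store v p d p → x = p := by
    intro x hx hxp
    rw [h.store_eq hx, store_self] at hxp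
    by_cases hp : p ∈ m
    · rw [Fits, if_pos hp] at h
      exact hv hx hp (hxp.trans h.symm)
    · rw [Fits, if_neg hp] at h
      exact absurd hxp (h x hx)
  rintro x (hx | rfl) y (hy | rfl) hxy
  · rw [h.store_eq hx, h.store_eq hy] at hxy
    exact hv hx hy hxy
  · exact key x hx hxy
  · exact (key y hy hxy.symm).symm
  · rfl

open Classical in
theorem evalPostfix_poolTest_iff {m : List ℕ} {v : ℕ → D} {p : ℕ} {d : D} :
    evalPostfix (fun r => decide (v r = d)) (poolTest p m) = true ↔ Fits m v p d := by
  rw [evalPostfix_poolTest, Fits]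
  split_ifs <;> simp

/-- The intermediate result from which the simulation of the outer transducer starts. -/
def startPartial (cf : NRTCode B C) (cg : NRTCode A B) (s : PairState) (p : ℕ)
    (k : TransitionCode A B) : Partial C :=
  (s.1.2, innerLocs (numRegs cf cg) p s k, [], false)

/-- The transition that reads a datum belonging in `p` and simulates the transition `k` of the inner
transducer and, with the result `x`, the outer one. -/
def pairTransition (cg : NRTCode A B) (s : PairState) (p : ℕ) (k : TransitionCode A B)
    (x : Partial C) : TransitionCode A C :=
  (Encodable.encode s, k.2.1, poolTest p s.2.1, [p], x.2.2.1,
    Encodable.encode (pairSucc cg.2.2.2.1 s k x))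

theorem mem_compose [Encodable B] {cf : NRTCode B C} {cg : NRTCode A B} {t : TransitionCode A C} :
    t ∈ (compose cf cg).2.2.2.2 ↔ ∃ s ∈ pairStates cf cg, ∃ p < 2 * numRegs cf cg + 1,
      ∃ k ∈ cg.2.2.2.2, k.1 = s.1.1 ∧ staticTest 0 p s.2.1 k.2.2.1 = true ∧
        ∃ x ∈ feedAll cf.2.2.2.1 cf.2.2.2.2 (2 * numRegs cf cg) (startPartial cf cg s p k)
          k.2.2.2.2.1, pairTransition cg s p k x = t := by
  simp only [compose, List.mem_flatMap, List.mem_range]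
  refine exists_congr fun s => and_congr_right fun _ => exists_congr fun p =>
    and_congr_right fun _ => exists_congr fun k => and_congr_right fun _ => ?_
  rw [pairTrans]
  split_ifs with h
  · rw [List.mem_map]
    exact ⟨fun h' => ⟨h.1, h.2, h'⟩, fun h' => h'.2.2⟩
  · simp only [List.not_mem_nil, false_iff]
    exact fun h' => h ⟨h'.1, h'.2.1⟩

theorem startPartial_wellFormed {cf : NRTCode B C} {cg : NRTCode A B} {s : PairState}
    (hs : s ∈ pairStates cf cg) {p : ℕ} (hp : p < 2 * numRegs cf cg + 1)
    (k : TransitionCode A B) : (startPartial cf cg s p k).WellFormed cf.1 (numRegs cf cg)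
      (Set.Iio (2 * numRegs cf cg + 1)) := by
  obtain ⟨-, h2, h3⟩ := mem_pairStates.mp hs
  exact ⟨h2, h3.relocate 0 hp _, by simp [startPartial]⟩

theorem pairSucc_mem [Encodable B] {cf : NRTCode B C} {cg : NRTCode A B}
    (hf : cf.Bounded (numRegs cf cg)) (hg : cg.Bounded (numRegs cf cg)) {s : PairState}
    (hs : s ∈ pairStates cf cg) {p : ℕ} (hp : p < 2 * numRegs cf cg + 1)
    {k : TransitionCode A B} (hk : k ∈ cg.2.2.2.2) {x : Partial C}
    (hx : x ∈ feedAll cf.2.2.2.1 cf.2.2.2.2 (2 * numRegs cf cg) (startPartial cf cg s p k)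
      k.2.2.2.2.1) :
    pairSucc cg.2.2.2.1 s k x ∈ pairStates cf cg ∧ ∀ y ∈ x.2.2.1, y.2 < 2 * numRegs cf cg + 1 := by
  have := (startPartial_wellFormed hs hp k).feedAll hf cf.2.2.2.1 (hg.out k hk) hx
  exact ⟨mem_pairStates.mpr ⟨hg.tgt k hk, this.state, this.locs⟩, this.out⟩

theorem mem_accepting_compose [Encodable B] {cf : NRTCode B C} {cg : NRTCode A B}
    {s : PairState} : Encodable.encode s ∈ (compose cf cg).2.2.2.1 ↔
      s ∈ pairStates cf cg ∧ allFlags s.2.2 = true := by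
  simp only [compose, List.mem_flatMap]
  constructor
  · rintro ⟨s', hs', h⟩
    split_ifs at h with hfl
    · rw [List.mem_singleton] at h
      exact Encodable.encode_injective h ▸ ⟨hs', hfl⟩
    · simp at h
  · rintro ⟨hs, hfl⟩
    exact ⟨s, hs, by simp [hfl]⟩

/-- The initial state. -/
def pairInit (cf : NRTCode B C) (cg : NRTCode A B) : PairState :=
  ((cg.2.2.1, cf.2.2.1), (List.range (2 * numRegs cf cg)).map fun _ => 0, false, false, false)

theorem pairInit_mem {cf : NRTCode B C} {cg : NRTCode A B}
    (hf : cf.Bounded (numRegs cf cg)) (hg : cg.Bounded (numRegs cf cg)) :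
    pairInit cf cg ∈ pairStates cf cg := by
  refine mem_pairStates.mpr ⟨hg.init, hf.init, by simp [pairInit], fun x hx => ?_⟩
  simp only [pairInit, List.mem_map] at hx
  obtain ⟨i, -, rfl⟩ := hx
  simp

theorem exists_codes_compose [Encodable B] {cf : NRTCode B C} {cg : NRTCode A B}
    (hf : cf.Bounded (numRegs cf cg)) (hg : cg.Bounded (numRegs cf cg)) :
    ∃ T : NRT A C, (compose cf cg).Codes T := by
  refine exists_codes_of_mem (List.mem_map_of_mem (pairInit_mem hf hg)) (fun q hq => ?_)
    (fun t ht => ?_)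
  · obtain ⟨s, hs, hq⟩ := List.mem_flatMap.mp hq
    split_ifs at hq
    · rw [List.mem_singleton.mp hq]
      exact List.mem_map_of_mem hs
    · simp at hq
  · obtain ⟨s, hs, p, hp, k, hk, -, -, x, hx, rfl⟩ := mem_compose.mp ht
    obtain ⟨h1, h2⟩ := pairSucc_mem hf hg hs hp hk hx
    refine ⟨List.mem_map_of_mem hs, List.mem_map_of_mem h1,
      exists_postfix_eq_poolTest (List.mem_range.mpr hp) fun q hq => ?_, fun r hr => ?_,
      fun y hy => List.mem_range.mpr (h2 y hy)⟩
    · exact List.mem_range.mpr ((mem_pairStates.mp hs).2.2.mem q hq)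
    · rw [List.mem_singleton.mp hr]
      exact List.mem_range.mpr hp

/-- The step `e` of the composition from the state `s` to the state `s'` simulates the step `eg` of
the inner transducer and the path `es` from `f` to `f'` of the outer one. -/
structure Simulates [Encodable B] (cf : NRTCode B C) (cg : NRTCode A B) (s : PairState)
    (e : Firing A C D) (eg : Firing A B D) (f : ℕ × (ℕ → D)) (es : List (Firing B C D))
    (f' : ℕ × (ℕ → D)) (s' : PairState) : Prop where
  valid : e.Valid (compose cf cg).2.2.2.2
  inner : eg.Valid cg.2.2.2.2
  path : IsPath cf.2.2.2.2 f es f'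
  inp : e.inp = eg.inp
  word : es.map Firing.inp = eg.out
  out : e.out = es.flatMap Firing.out
  tgt : e.tgt.1 = Encodable.encode s'
  rep : PairRep cf cg s' e.tgt.2 eg.tgt f'
  flags : ∃ ev : Bool × Bool × Bool, s'.2.2 = raiseFlags s.2.2 ev ∧
    (ev.1 = true ↔ eg.tgt.1 ∈ cg.2.2.2.1) ∧
    (ev.2.1 = true ↔ ∃ e ∈ es, e.tgt.1 ∈ cf.2.2.2.1) ∧ (ev.2.2 = true ↔ e.out ≠ [])

/-- The pool registers that can be in use after a step. -/
abbrev usedLocs (s : PairState) (p : ℕ) : Set ℕ := {x | x ∈ s.2.1 ∨ x = p}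

theorem PairRep.represents_store {cf : NRTCode B C} {cg : NRTCode A B} {s : PairState}
    {v : ℕ → D} {g f : ℕ × (ℕ → D)} (h : PairRep cf cg s v g f) {p : ℕ} {d : D}
    (hfit : Fits s.2.1 v p d) {e : ℕ} (he : e < 2) {τ : ℕ → D}
    (hr : Represents e (numRegs cf cg) s.2.1 v τ) :
    Represents e (numRegs cf cg) s.2.1 (store v p d) τ := by
  intro r hrN
  rw [hr r hrN, hfit.store_eq]
  exact getD_mem_of_lt (by have := (mem_pairStates.mp h.mem).2.2.length; omega)

theorem PairRep.locs {cf : NRTCode B C} {cg : NRTCode A B} {s : PairState}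
    {v : ℕ → D} {g f : ℕ × (ℕ → D)} (h : PairRep cf cg s v g f) (p : ℕ) :
    LocList (numRegs cf cg) (usedLocs s p) s.2.1 :=
  ⟨(mem_pairStates.mp h.mem).2.2.length, fun _ hx => Or.inl hx⟩

open Classical in
-- Tests are judged in the pool after the store: there the old inner valuation is still represented
-- and `d` has the location `p`.
theorem PairRep.staticTest_eq {cf : NRTCode B C} {cg : NRTCode A B} {s : PairState}
    {v : ℕ → D} {g f : ℕ × (ℕ → D)} (h : PairRep cf cg s v g f) {p : ℕ} {d : D}
    (hfit : Fits s.2.1 v p d) {test : List (ℕ × ℕ)} (ht : ∀ t ∈ test, t.2 < numRegs cf cg) :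
    staticTest 0 p s.2.1 test = evalPostfix (fun r => decide (g.2 r = d)) test := by
  rw [(h.represents_store hfit (by omega) h.inner).staticTest_eq (by omega) (h.locs p)
    (hfit.injOn_store h.inj) (Or.inr rfl) ht, store_self]

theorem PairRep.start {cf : NRTCode B C} {cg : NRTCode A B} {s : PairState}
    {v : ℕ → D} {f : ℕ × (ℕ → D)} {eg : Firing A B D} (h : PairRep cf cg s v eg.src f) {p : ℕ}
    (hfit : Fits s.2.1 v p eg.inp.2) :
    (startPartial cf cg s p eg.code).Rep (numRegs cf cg) (usedLocs s p) (store v p eg.inp.2)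
      eg.tgt.2 f := by
  refine ⟨congrArg Prod.snd h.state, (h.locs p).relocate 0 (Or.inr rfl) _, ?_, ?_⟩
  · have := (h.represents_store hfit (by omega) h.inner).relocate (by omega) p eg.code.2.2.2.1
    rw [store_self] at this
    exact this
  · exact (h.represents_store hfit (by omega) h.outer).relocate_of_ne (by omega) (by omega) _ _

/-- The part common to both directions: once the guess `p` and the symbolic result `x` match the
inner firing and the outer path, the corresponding transition of the composition does what is
required. -/
theorem PairRep.simulates [Encodable B] {cf : NRTCode B C} {cg : NRTCode A B}
    (hf : cf.Bounded (numRegs cf cg)) (hg : cg.Bounded (numRegs cf cg)) {s : PairState}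
    {v : ℕ → D} {f f' : ℕ × (ℕ → D)} {eg : Firing A B D} (h : PairRep cf cg s v eg.src f)
    (heg : eg.Valid cg.2.2.2.2) {p : ℕ} (hp : p < 2 * numRegs cf cg + 1)
    (hfit : Fits s.2.1 v p eg.inp.2) {es : List (Firing B C D)}
    (hes : IsPath cf.2.2.2.2 f es f') (hword : es.map Firing.inp = eg.out) {x : Partial C}
    (hx : x ∈ feedAll cf.2.2.2.1 cf.2.2.2.2 (2 * numRegs cf cg) (startPartial cf cg s p eg.code)
      eg.code.2.2.2.2.1)
    (hrep : x.Rep (numRegs cf cg) (usedLocs s p) (store v p eg.inp.2) eg.tgt.2 f')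
    (htr : Partial.Tracks cf.2.2.2.1 (store v p eg.inp.2) (startPartial cf cg s p eg.code) x es) :
    Simulates cf cg s ⟨pairTransition cg s p eg.code x, (Encodable.encode s, v), eg.inp⟩ eg f es f'
      (pairSucc cg.2.2.2.1 s eg.code x) := by
  obtain ⟨hk, hk1, hk2, hk3⟩ := heg
  have hst := h.staticTest_eq hfit (hg.test _ hk)
  have hout : x.2.2.1.map (fun y => (y.1, store v p eg.inp.2 y.2)) = es.flatMap Firing.out := by
    simpa [Partial.word, startPartial] using htr.word
  refine ⟨⟨?_, rfl, hk2, ?_⟩, ⟨hk, hk1, hk2, hk3⟩, hes, rfl, hword, hout, rfl, ?_,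
    ⟨_, rfl, ?_, ?_, ?_⟩⟩
  · exact mem_compose.mpr ⟨s, h.mem, p, hp, _, hk, hk1.trans (congrArg Prod.fst h.state).symm,
      hst.trans hk3, x, hx, rfl⟩
  · exact evalPostfix_poolTest_iff.mpr hfit
  -- The transition assigns exactly `[p]`, so the valuation reached is `store v p eg.inp.2` by
  -- definition.
  · refine ⟨(pairSucc_mem hf hg h.mem hp hk hx).1, ?_, hrep.inner, hrep.outer, ?_⟩
    · exact Prod.ext rfl hrep.state
    · exact (hfit.injOn_store h.inj).mono hrep.locs.mem
  · simp [Firing.tgt]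
  · simpa [startPartial] using htr.visit
  · change (!decide (x.2.2.1 = [])) = true ↔ x.2.2.1.map _ ≠ []
    simp

theorem PairRep.exists_simulates_of_valid [Encodable B] {cf : NRTCode B C} {cg : NRTCode A B}
    (hf : cf.Bounded (numRegs cf cg)) (hg : cg.Bounded (numRegs cf cg)) {s : PairState}
    {g f : ℕ × (ℕ → D)} {e : Firing A C D} (hs : e.src.1 = Encodable.encode s)
    (h : PairRep cf cg s e.src.2 g f) (he : e.Valid (compose cf cg).2.2.2.2) :
    ∃ (eg : Firing A B D) (es : List (Firing B C D)) (f' : ℕ × (ℕ → D)) (s' : PairState),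
      eg.src = g ∧ Simulates cf cg s e eg f es f' s' := by
  classical
  obtain ⟨code, ⟨st, v⟩, inp⟩ := e
  obtain ⟨hk, hk1, hk2, hk3⟩ := he
  obtain ⟨s₁, hs₁, p, hp, k, hkg, hksrc, hst, x, hx, rfl⟩ := mem_compose.mp hk
  obtain rfl : s₁ = s := Encodable.encode_injective (hk1.trans hs)
  change st = _ at hs
  subst hs
  have hfit : Fits s₁.2.1 v p inp.2 := evalPostfix_poolTest_iff.mp hk3
  let eg : Firing A B D := ⟨k, g, inp⟩
  have heg : eg.Valid cg.2.2.2.2 := by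
    refine ⟨hkg, hksrc.trans (congrArg Prod.fst h.state), hk2, ?_⟩
    rw [h.staticTest_eq hfit (hg.test _ hkg)] at hst
    exact hst
  obtain ⟨es, f', h1, h2, h3, h4⟩ := Partial.Rep.exists_path hf (hfit.injOn_store h.inj)
    cf.2.2.2.1 (hg.out k hkg) (PairRep.start (eg := eg) h hfit) hx
  exact ⟨eg, es, f', _, rfl, PairRep.simulates (eg := eg) hf hg h heg hp hfit h1 h2 hx h3 h4⟩

theorem PairRep.exists_simulates_of_path [Encodable B] {cf : NRTCode B C} {cg : NRTCode A B}
    (hf : cf.Bounded (numRegs cf cg)) (hg : cg.Bounded (numRegs cf cg)) {s : PairState}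
    {v : ℕ → D} {f f' : ℕ × (ℕ → D)} {eg : Firing A B D} (h : PairRep cf cg s v eg.src f)
    (heg : eg.Valid cg.2.2.2.2) {es : List (Firing B C D)} (hes : IsPath cf.2.2.2.2 f es f')
    (hword : es.map Firing.inp = eg.out) :
    ∃ (e : Firing A C D) (s' : PairState), e.src = (Encodable.encode s, v) ∧
      Simulates cf cg s e eg f es f' s' := by
  -- The correct guess is a used location that holds the datum. If there is none, it is an unused
  -- register, which exists because `2 * N` entries cannot exhaust `2 * N + 1` registers.
  obtain ⟨p, hp, hfit⟩ : ∃ p < 2 * numRegs cf cg + 1, Fits s.2.1 v p eg.inp.2 := by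
    have hl := (mem_pairStates.mp h.mem).2.2
    by_cases hd : ∃ p ∈ s.2.1, v p = eg.inp.2
    · obtain ⟨p, hp, hpd⟩ := hd
      exact ⟨p, hl.mem p hp, by rw [Fits, if_pos hp]; exact hpd⟩
    · obtain ⟨p, hp, hpm⟩ := exists_fresh (n := 2 * numRegs cf cg + 1) (m := s.2.1)
        (by have := hl.length; omega)
      exact ⟨p, hp, by rw [Fits, if_neg hpm]; exact fun q hq hqd => hd ⟨q, hq, hqd⟩⟩
  obtain ⟨x, hx, h1, h2⟩ := (h.start hfit).exists_mem_feedAll hf (hfit.injOn_store h.inj)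
    cf.2.2.2.1 (hg.out _ heg.1) hes hword
  exact ⟨_, _, rfl, h.simulates hf hg heg hp hfit hes hword hx h1 h2⟩

/-- Injectivity holds although the pool is constant, since only location `0` is in use. -/
theorem pairRep_init {cf : NRTCode B C} {cg : NRTCode A B}
    (hf : cf.Bounded (numRegs cf cg)) (hg : cg.Bounded (numRegs cf cg)) (d₀ : D) :
    PairRep cf cg (pairInit cf cg) (fun _ => d₀) (cg.2.2.1, fun _ => d₀)
      (cf.2.2.1, fun _ => d₀) := by
  refine ⟨pairInit_mem hf hg, rfl, fun _ _ => rfl, fun _ _ => rfl, fun x hx y hy _ => ?_⟩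
  simp only [pairInit, List.mem_map, Set.mem_ofPred_eq] at hx hy
  obtain ⟨_, -, rfl⟩ := hx
  obtain ⟨_, -, rfl⟩ := hy
  rfl

end Simulation

/-! ### Finite paths and infinite runs of the outer transducer -/

section Paths

variable {B C D : Type*} {trans : List (TransitionCode B C)}

theorem IsPath.append {c c' c'' : ℕ × (ℕ → D)} {es es' : List (Firing B C D)}
    (h : IsPath trans c es c') (h' : IsPath trans c' es' c'') :
    IsPath trans c (es ++ es') c'' := by
  induction es generalizing c with
  | nil => exact (show c = c' from h) ▸ h'
  | cons e es ih => exact ⟨h.1, h.2.1, ih h.2.2⟩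

theorem IsPath.concatUpTo {c : ℕ → ℕ × (ℕ → D)} {es : ℕ → List (Firing B C D)}
    (h : ∀ n, IsPath trans (c n) (es n) (c (n + 1))) (n : ℕ) :
    IsPath trans (c 0) (concatUpTo es n) (c n) := by
  induction n with
  | zero => exact rfl
  | succ n ih => exact concatUpTo_succ es n ▸ ih.append (h n)

theorem IsPath.getElem {c c' : ℕ × (ℕ → D)} {es : List (Firing B C D)}
    (h : IsPath trans c es c') :
    (∀ i (hi : i < es.length), es[i].Valid trans) ∧
      (∀ i (hi : i + 1 < es.length), es[i].tgt = es[i + 1].src) ∧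
      ∀ hi : 0 < es.length, es[0].src = c := by
  induction es generalizing c with
  | nil => simp
  | cons e es ih =>
    obtain ⟨rfl, h2, h3⟩ := h
    obtain ⟨i1, i2, i3⟩ := ih h3
    refine ⟨fun i hi => ?_, fun i hi => ?_, fun _ => rfl⟩
    · cases i with
      | zero => exact h2
      | succ i => exact i1 i (by simpa using hi)
    · cases i with
      | zero => exact (i3 (by simpa using hi)).symm
      | succ i => exact i2 i (by simpa using hi)

theorem isPath_slice {e : ℕ → Firing B C D} (hv : ∀ n, (e n).Valid trans)
    (hl : ∀ n, (e n).tgt = (e (n + 1)).src) (m n : ℕ) :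
    IsPath trans (e m).src ((List.range n).map fun i => e (m + i)) (e (m + n)).src := by
  induction n with
  | zero => exact rfl
  | succ n ih =>
    rw [List.range_succ, List.map_append]
    exact ih.append ⟨rfl, hv _, hl _⟩

end Paths

/-! ### Three recurrence conditions as one Büchi condition -/

section Flags

open Filter

theorem frequently_succ_iff {P : ℕ → Prop} :
    (∃ᶠ n in atTop, P (n + 1)) ↔ ∃ᶠ n in atTop, P n := by
  simp only [frequently_atTop]
  constructor
  · intro h N
    obtain ⟨n, hn, hP⟩ := h N
    exact ⟨n + 1, by omega, hP⟩
  · intro h N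
    obtain ⟨n, hn, hP⟩ := h (N + 1)
    exact ⟨n - 1, by omega, by rwa [Nat.sub_add_cancel (by omega)]⟩

/-- A flag that is raised by the event `ev` and reset at `full` is up at two times of reset only if
the event occurs in between. -/
theorem frequently_event {fl ev full : ℕ → Bool}
    (hstep : ∀ n, fl (n + 1) = ((!full n && fl n) || ev n))
    (hfull : ∀ n, full n = true → fl n = true) (h : ∃ᶠ n in atTop, full n = true) :
    ∃ᶠ n in atTop, ev n = true := by
  rw [frequently_atTop] at h ⊢
  intro N
  by_contra! hc
  obtain ⟨n, hn, hfn⟩ := h N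
  have hdown (m : ℕ) (hm : n + 1 ≤ m) : fl m = false := by
    induction m, hm using Nat.le_induction with
    | base => simp [hstep, hfn, hc n hn]
    | succ m hm ih => simp [hstep, ih, hc m (by omega)]
  obtain ⟨m, hm, hfm⟩ := h (n + 1)
  simpa [hdown m hm] using hfull m hfm

/-- A flag that is never reset stays up after the first event. -/
theorem eventually_up {fl ev full : ℕ → Bool}
    (hstep : ∀ n, fl (n + 1) = ((!full n && fl n) || ev n))
    (hfull : ∀ᶠ n in atTop, full n = false) (h : ∃ᶠ n in atTop, ev n = true) :
    ∀ᶠ n in atTop, fl n = true := by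
  obtain ⟨N, hN⟩ := eventually_atTop.mp hfull
  obtain ⟨n, hn, hev⟩ := frequently_atTop.mp h N
  refine eventually_atTop.mpr ⟨n + 1, fun m hm => ?_⟩
  induction m, hm using Nat.le_induction with
  | base => simp [hstep, hev]
  | succ m hm ih => simp [hstep, ih, hN m (by omega)]

/-- Between two resets every event must occur. Conversely, if resets stopped, each recurring event
would raise its flag for good, and all flags would be up together, a contradiction. -/
theorem frequently_allFlags_iff {fl ev : ℕ → Bool × Bool × Bool}
    (h : ∀ n, fl (n + 1) = raiseFlags (fl n) (ev n)) :
    (∃ᶠ n in atTop, allFlags (fl n) = true) ↔ (∃ᶠ n in atTop, (ev n).1 = true) ∧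
      (∃ᶠ n in atTop, (ev n).2.1 = true) ∧ ∃ᶠ n in atTop, (ev n).2.2 = true := by
  have h1 (n : ℕ) : (fl (n + 1)).1 = ((!allFlags (fl n) && (fl n).1) || (ev n).1) := by
    rw [h]; rfl
  have h2 (n : ℕ) : (fl (n + 1)).2.1 = ((!allFlags (fl n) && (fl n).2.1) || (ev n).2.1) := by
    rw [h]; rfl
  have h3 (n : ℕ) : (fl (n + 1)).2.2 = ((!allFlags (fl n) && (fl n).2.2) || (ev n).2.2) := by
    rw [h]; rfl
  have hall (n : ℕ) : allFlags (fl n) = true ↔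
      (fl n).1 = true ∧ (fl n).2.1 = true ∧ (fl n).2.2 = true := by
    simp [allFlags]
  constructor
  · exact fun hf => ⟨frequently_event h1 (fun n hn => ((hall n).mp hn).1) hf,
      frequently_event h2 (fun n hn => ((hall n).mp hn).2.1) hf,
      frequently_event h3 (fun n hn => ((hall n).mp hn).2.2) hf⟩
  · rintro ⟨e1, e2, e3⟩ hc
    have hfull : ∀ᶠ n in atTop, allFlags (fl n) = false :=
      hc.mono fun n hn => by simpa using hn
    obtain ⟨n, hn, h4, h5, h6⟩ := (hfull.and ((eventually_up (fl := fun n => (fl n).1) h1 hfull e1).and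
      ((eventually_up (fl := fun n => (fl n).2.1) h2 hfull e2).and
        (eventually_up (fl := fun n => (fl n).2.2) h3 hfull e3)))).exists
    rw [(hall n).mpr ⟨h4, h5, h6⟩] at hn
    cases hn

end Flags

/-! ### Accepting runs of the composition -/

section Composition

open Filter

variable {A B C D : Type*} [Encodable B] {cf : NRTCode B C} {cg : NRTCode A B} {d₀ : D}

/-- The acceptance condition of the composition. -/
theorem Simulates.frequently_iff {s : ℕ → PairState} {e : ℕ → Firing A C D}
    {eg : ℕ → Firing A B D} {f : ℕ → ℕ × (ℕ → D)} {es : ℕ → List (Firing B C D)}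
    (h : ∀ n, Simulates cf cg (s n) (e n) (eg n) (f n) (es n) (f (n + 1)) (s (n + 1))) :
    (∃ᶠ n in atTop, (e n).tgt.1 ∈ (compose cf cg).2.2.2.1) ↔
      (∃ᶠ n in atTop, (eg n).tgt.1 ∈ cg.2.2.2.1) ∧
      (∃ᶠ n in atTop, ∃ x ∈ es n, x.tgt.1 ∈ cf.2.2.2.1) ∧ ∃ᶠ n in atTop, (e n).out ≠ [] := by
  choose ev h1 h2 h3 h4 using fun n => (h n).flags
  have h5 (n : ℕ) : (e n).tgt.1 ∈ (compose cf cg).2.2.2.1 ↔ allFlags (s (n + 1)).2.2 = true := by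
    rw [(h n).tgt, mem_accepting_compose, and_iff_right (h n).rep.mem]
  simp only [h5, ← h2, ← h3, ← h4]
  rw [frequently_succ_iff (P := fun n => allFlags (s n).2.2 = true), frequently_allFlags_iff h1]

/-- Accepting runs of both transducers are read off an accepting run of the composition. -/
theorem AccRun.exists_of_compose (hf : cf.Bounded (numRegs cf cg))
    (hg : cg.Bounded (numRegs cf cg)) {e : ℕ → Firing A C D}
    (he : AccRun d₀ (compose cf cg) e) : (∃ᶠ n in atTop, (e n).out ≠ []) ∧
      ∃ (eg : ℕ → Firing A B D) (ef : ℕ → Firing B C D), AccRun d₀ cg eg ∧ AccRun d₀ cf ef ∧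
        (∀ n, (eg n).inp = (e n).inp) ∧
        HasConcat (fun n => (eg n).out) (fun n => (ef n).inp) ∧
        ∀ z, HasConcat (fun n => (e n).out) z → HasConcat (fun n => (ef n).out) z := by
  obtain ⟨u, hu0, hu⟩ := exists_seq_of_step
    (X := PairState × (ℕ × (ℕ → D)) × (ℕ × (ℕ → D)))
    (P := fun n x => (e n).src.1 = Encodable.encode x.1 ∧
      PairRep cf cg x.1 (e n).src.2 x.2.1 x.2.2)
    (R := fun n x x' => ∃ (eg : Firing A B D) (es : List (Firing B C D)),
      eg.src = x.2.1 ∧ eg.tgt = x'.2.1 ∧ Simulates cf cg x.1 (e n) eg x.2.2 es x'.2.2 x'.1)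
    (x₀ := (pairInit cf cg, (cg.2.2.1, fun _ => d₀), (cf.2.2.1, fun _ => d₀)))
    (by rw [he.init]; exact ⟨rfl, pairRep_init hf hg d₀⟩)
    (by
      rintro n ⟨s, g, f⟩ ⟨h1, h2⟩
      obtain ⟨eg, es, f', s', h3, h4⟩ := h2.exists_simulates_of_valid hf hg h1 (he.valid n)
      refine ⟨(s', eg.tgt, f'), ?_, eg, es, h3, rfl, h4⟩
      rw [← he.link]
      exact ⟨h4.tgt, h4.rep⟩)
  choose eg es hsrc htgt hsim using fun n => (hu n).2
  obtain ⟨hgacc, hfacc, hout⟩ := (Simulates.frequently_iff hsim).mp he.acc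
  -- An empty outer path writes nothing, so recurring output forces infinitely many nonempty paths.
  -- Hence their concatenation `ef` is an infinite outer run.
  have hne : ∃ᶠ n in atTop, es n ≠ [] := hout.mono fun n hn hes => hn (by simp [(hsim n).out, hes])
  obtain ⟨ef, hef⟩ := exists_hasConcat (infinite_concat_iff.mpr hne)
  have hpath := IsPath.concatUpTo (c := fun n => (u n).2.2) fun n => (hsim n).path
  have hget (n i : ℕ) (hi : i < (concatUpTo es n).length) : (concatUpTo es n)[i] = ef i :=
    eq_map_range_iff.mp (hef.2 n) i hi
  refine ⟨hout, eg, ef, ⟨fun n => (hsim n).inner, fun n => ?_, ?_, hgacc⟩,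
    ⟨fun j => ?_, fun j => ?_, ?_, ?_⟩, fun n => (hsim n).inp.symm, ?_, fun z hz => ?_⟩
  · rw [htgt, hsrc]
  · rw [hsrc, hu0]
  · obtain ⟨n, hn⟩ := hef.1 (j + 1)
    exact hget n j hn ▸ (hpath n).getElem.1 j hn
  · obtain ⟨n, hn⟩ := hef.1 (j + 2)
    rw [← hget n j (by omega), ← hget n (j + 1) (by omega)]
    exact (hpath n).getElem.2.1 j hn
  · obtain ⟨n, hn⟩ := hef.1 1
    rw [← hget n 0 hn, (hpath n).getElem.2.2 hn, hu0]
  · exact (hef.frequently_iff fun x => x.tgt.1 ∈ cf.2.2.2.1).mpr hfacc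
  · have := hef.map Firing.inp
    simp only [fun n => (hsim n).word] at this
    exact this
  · simp only [fun n => (hsim n).out] at hz
    exact (hef.flatMap_iff _).mp hz

/-- Accepting runs of both transducers are combined into one of the composition. -/
theorem AccRun.compose (hf : cf.Bounded (numRegs cf cg))
    (hg : cg.Bounded (numRegs cf cg)) {eg : ℕ → Firing A B D} {ef : ℕ → Firing B C D}
    (heg : AccRun d₀ cg eg) (hef : AccRun d₀ cf ef)
    (hio : HasConcat (fun n => (eg n).out) (fun n => (ef n).inp)) {z : DataWord C D}
    (hz : HasConcat (fun n => (ef n).out) z) :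
    ∃ e : ℕ → Firing A C D, AccRun d₀ (compose cf cg) e ∧ (∀ n, (e n).inp = (eg n).inp) ∧
      HasConcat (fun n => (e n).out) z := by
  -- `L n` counts the letters written by the inner run before step `n`, hence the outer firings made
  -- so far; `es n` is the block that reads the word written in step `n`.
  let L : ℕ → ℕ := fun n => (concatUpTo (fun n => (eg n).out) n).length
  let es : ℕ → List (Firing B C D) := fun n =>
    (List.range (eg n).out.length).map fun i => ef (L n + i)
  have hword (n : ℕ) : (es n).map Firing.inp = (eg n).out := by
    rw [hio.slice n, List.map_map]
    rfl
  have hL (n : ℕ) : (concatUpTo es n).length = L n := by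
    rw [← List.length_map Firing.inp, ← concatUpTo_map]
    simp only [hword]
    rfl
  have hcon : HasConcat es ef := by
    refine HasConcat.of_slice (fun N => ?_) fun n => ?_
    · obtain ⟨n, hn⟩ := hio.1 N
      exact ⟨n, (hL n).symm ▸ hn⟩
    · simp [es, hL]
  have hpath (n : ℕ) : IsPath cf.2.2.2.2 (ef (L n)).src (es n) (ef (L (n + 1))).src := by
    have hLs : L (n + 1) = L n + (eg n).out.length := by
      simp [L, concatUpTo_succ]
    rw [hLs]
    exact isPath_slice hef.valid hef.link _ _
  obtain ⟨u, hu0, hu⟩ := exists_seq_of_step (X := PairState × (ℕ → D))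
    (P := fun n x => PairRep cf cg x.1 x.2 (eg n).src (ef (L n)).src)
    (R := fun n x x' => ∃ e : Firing A C D, e.src = (Encodable.encode x.1, x.2) ∧ e.tgt.2 = x'.2 ∧
      Simulates cf cg x.1 e (eg n) (ef (L n)).src (es n) (ef (L (n + 1))).src x'.1)
    (x₀ := (pairInit cf cg, fun _ => d₀))
    (by
      change PairRep cf cg _ _ (eg 0).src (ef 0).src
      rw [heg.init, hef.init]
      exact pairRep_init hf hg d₀)
    (by
      rintro n ⟨s, v⟩ h
      obtain ⟨e, s', h1, h2⟩ := h.exists_simulates_of_path hf hg (heg.valid n) (hpath n) (hword n)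
      exact ⟨(s', e.tgt.2), heg.link n ▸ h2.rep, e, h1, rfl, h2⟩)
  choose e hsrc htgt hsim using fun n => (hu n).2
  have hout : HasConcat (fun n => (e n).out) z := by
    simp only [fun n => (hsim n).out]
    exact (hcon.flatMap_iff _).mpr hz
  refine ⟨e, ⟨fun n => (hsim n).valid, fun n => ?_, ?_, ?_⟩, fun n => (hsim n).inp, hout⟩
  · rw [hsrc]
    exact Prod.ext (hsim n).tgt (htgt n)
  · rw [hsrc, hu0]
    rfl
  · exact (Simulates.frequently_iff (f := fun n => (ef (L n)).src) hsim).mpr ⟨heg.acc,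
      (hcon.frequently_iff _).mp hef.acc, infinite_concat_iff.mp hout.1⟩

/-- The transducers with the code `compose cf cg` define the composition. -/
theorem exists_compose {Tf : NRT B C} {Tg : NRT A B} (hf : cf.Codes Tf) (hg : cg.Codes Tg) :
    ∃ T : NRT A C, (compose cf cg).Codes T ∧ T.InfiniteOutputs d₀ ∧
      T.rel d₀ = (Tg.rel d₀).comp (Tf.rel d₀) := by
  have hbf : cf.Bounded (numRegs cf cg) := hf.bounded (by unfold numRegs; omega)
  have hbg : cg.Bounded (numRegs cf cg) := hg.bounded (by unfold numRegs; omega)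
  obtain ⟨T, hT⟩ := exists_codes_compose hbf hbg
  refine ⟨T, hT, hT.infiniteOutputs fun e he => (he.exists_of_compose hbf hbg).1, ?_⟩
  ext ⟨x, z⟩
  rw [hT.mem_rel_iff, SetRel.mem_comp]
  constructor
  · rintro ⟨e, he, hx, hz⟩
    obtain ⟨-, eg, ef, heg, hef, hin, hio, hout⟩ := he.exists_of_compose hbf hbg
    exact ⟨fun n => (ef n).inp, hg.mem_rel_iff.mpr ⟨eg, heg, fun n => (hin n).trans (hx n), hio⟩,
      hf.mem_rel_iff.mpr ⟨ef, hef, fun _ => rfl, hout z hz⟩⟩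
  · rintro ⟨y, hxy, hyz⟩
    obtain ⟨eg, heg, hx, hy⟩ := hg.mem_rel_iff.mp hxy
    obtain ⟨ef, hef, hy', hz⟩ := hf.mem_rel_iff.mp hyz
    obtain rfl : (fun n => (ef n).inp) = y := funext hy'
    obtain ⟨e, he, hin, hout⟩ := AccRun.compose hbf hbg heg hef hy hz
    exact ⟨e, he, fun n => (hin n).trans (hx n), hout⟩

end Composition

end NRTCode

/-! ### The theorem -/

theorem PFun.graph_comp {X Y Z : Type*} (f : Y →. Z) (g : X →. Y) :
    (f.comp g).graph = SetRel.comp g.graph f.graph := by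
  ext ⟨x, z⟩
  exact Part.mem_bind_iff

theorem mainTheorem6 {A B C D : Type*}
    [Finite A] [Primcodable A] [Finite B] [Primcodable B] [Finite C] [Primcodable C]
    [Countable D] [Infinite D] (d₀ : D) :
    -- functions definable by transducers are closed under composition
    (∀ (f : DataWord B D →. DataWord C D) (g : DataWord A D →. DataWord B D),
      NRT.DefinableFun d₀ f → NRT.DefinableFun d₀ g → NRT.DefinableFun d₀ (f.comp g)) ∧
    -- so are relations
    (∀ (r : SetRel (DataWord B D) (DataWord C D)) (s : SetRel (DataWord A D) (DataWord B D)),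
      NRT.DefinableRel d₀ r → NRT.DefinableRel d₀ s → NRT.DefinableRel d₀ (s.comp r)) ∧
    -- and a transducer for the composition is computable from the two given ones
    (∃ compose : NRTCode B C → NRTCode A B → NRTCode A C, Computable₂ compose ∧
      ∀ (cf : NRTCode B C) (cg : NRTCode A B) (Tf : NRT B C) (Tg : NRT A B),
        cf.Codes Tf → cg.Codes Tg →
        ∃ T : NRT A C, (compose cf cg).Codes T ∧ T.InfiniteOutputs d₀ ∧
          T.rel d₀ = (Tg.rel d₀).comp (Tf.rel d₀) ∧
          ∀ (f : DataWord B D →. DataWord C D) (g : DataWord A D →. DataWord B D),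
            Tf.rel d₀ = f.graph → Tg.rel d₀ = g.graph → T.rel d₀ = (f.comp g).graph) := by
  have key : ∀ (r : SetRel (DataWord B D) (DataWord C D))
      (s : SetRel (DataWord A D) (DataWord B D)),
      NRT.DefinableRel d₀ r → NRT.DefinableRel d₀ s → NRT.DefinableRel d₀ (s.comp r) := by
    rintro r s ⟨Tf, -, rfl⟩ ⟨Tg, -, rfl⟩
    obtain ⟨cf, hf⟩ := NRTCode.exists_codes Tf
    obtain ⟨cg, hg⟩ := NRTCode.exists_codes Tg
    obtain ⟨T, -, h1, h2⟩ := NRTCode.exists_compose (d₀ := d₀) hf hg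
    exact ⟨T, h1, h2⟩
  refine ⟨fun f g hf hg => ?_, key, NRTCode.compose, NRTCode.primrec_compose.to_comp,
    fun cf cg Tf Tg hf hg => ?_⟩
  · have := key f.graph g.graph hf hg
    rwa [← PFun.graph_comp] at this
  · obtain ⟨T, h1, h2, h3⟩ := NRTCode.exists_compose (d₀ := d₀) hf hg
    refine ⟨T, h1, h2, h3, fun f g hf' hg' => ?_⟩
    rw [h3, hf', hg', PFun.graph_comp]
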